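/- Let $\Sigma=\{a,b\}$, $a<b$, and order finite and infinite words lexicographically. A morphism $f$ of words is given by the images of letters, and $\sigma$ denotes the shift (erasing the first symbol). A fixed point of a morphism $f$ means an infinite word of the form $w=\lim_{n\to\infty} f^n(x)$, where $x$ is a letter, $f(x)$ starts with $x$ and $|f^n(x)|\to\infty$; its subshift $L_w$ is the closure of its orbit under $\sigma$. The morphism $f$ is order-preserving on a set $L$ of infinite words if for all $u,v\in L$ we have $u<v \iff f(u)<f(v)$. Separability. Let $L$ be the subshift of a fixed point of $f$. A representation of $u\in L$ is a pair $(u',p)$ with $u'\in L$, $0\le p<|f(u'[0])|$ and $u=\sigma^p(f(u'))$. If it is unique, then $(u'[0],p)$ is the type of $u$. The subshift $L$ is separable if each $u\in L$ has a unique representation and the set of possible types $\{(c,p): 0\le p<|f(c)|\}$ can be totally ordered so that $u<v$ whenever $u,v\in L$ and the type of $u$ is less than the type of $v$. Let $\varphi$ be a morphism on $\Sigma$ and let $w$ be an aperiodic (that is, not ultimately periodic), uniformly recurrent fixed point of $\varphi$; put $L_\varphi=L_w$. The boundaries in $w=\varphi(w)$ are the positions $|\varphi(w[0]\cdots w[j-1])|$,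 $j\ge 0$. A synchronization point of a factor $u$ of $w$ is a place $0\le k\le|u|$ such that for every occurrence of $u$ in $w$, at a position $i$, the position $i+k$ is a boundary. Suppose that $w$ is circular with synchronization delay $D\ge 1$: every factor of $w$ of length at least $D$ has a synchronization point and contains both letters. Let $A_D$ be the set of factors of $w$ of length $D$, considered as an alphabet with the lexicographic order. For a factor $v$ of $w$ with $|v|\ge D$, let $\pi(v)$ be the word over $A_D$ of length $|v|-D+1$ formed by the successive factors of length $D$ of $v$. Let $\rho:A_D\to\Sigma$ send each factor to its first letter; extend $\rho$ to infinite words letter by letter. Define the morphism $\chi$ on $A_D$ as follows: if $u\in A_D$ starts with the letter $x$, then $\chi(u)$ is the prefix of length $|\varphi(x)|$ of $\pi(\varphi(u))$. Below, $L_\chi$ denotes the subshift of any fixed point of $\chi$. Then: 1. If $\varphi$ is order-preserving on $L_\varphi$, then $\chi$ is order-preserving on $L_\chi$. 2. If $\varphi(a)$ and $\varphi(b)$ end by different letters, then different $\chi$-images of letters of $A_D$ end by different letters of $A_D$, and these last letters do not occur in $\chi$-images of letters at any place other than the last one. 3. $\rho$ is a bijection from the set of fixed points of $\chi$ onto the set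 of fixed points of $\varphi$. (So there are as many fixed points of $\chi$ as of $\varphi$, and every fixed point of $\varphi$ is the $\rho$-image of a fixed point of $\chi$.) Likewise, $\rho$ is a bijection from $\{y\in L_\chi:\chi(y)=y\}$ onto $\{u\in L_\varphi:\varphi(u)=u\}$. 4. If $\varphi(a)$ and $\varphi(b)$ end by different letters, then $\rho$ is an isomorphism of the subshifts $(L_\chi,\sigma)$ and $(L_\varphi,\sigma)$ (a homeomorphism $L_\chi\to L_\varphi$ commuting with $\sigma$), and it preserves the lexicographic order: $y<y' \iff \rho(y)<\rho(y')$ for $y,y'\in L_\chi$. 5. If $\varphi(a)$ and $\varphi(b)$ end by different letters, then the subshift $L_\chi$ is separable. -/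

import Mathlib

namespace Morphic

/-- The factor `w[i] ⋯ w[i+n-1]` of length `n` of an infinite word. -/
def factorAt {α : Type} (w : ℕ → α) (i n : ℕ) : List α :=
  (List.range n).map fun j => w (i + j)

/-- The finite word `u` occurs in the infinite word `w` at position `i`. -/
def OccursAt {α : Type} (u : List α) (w : ℕ → α) (i : ℕ) : Prop :=
  factorAt w i u.length = u

/-- `u` is a factor of the infinite word `w`. -/
def IsFactor {α : Type} (u : List α) (w : ℕ → α) : Prop :=
  ∃ i, OccursAt u w i

/-- The shift, erasing the first symbol. -/
def shift {α : Type} (w : ℕ → α) : ℕ → α := fun n => w (n + 1)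

/-- The subshift generated by `w`: the closure of its orbit under the shift, in the product
topology (the theorem uses it for discrete alphabets). -/
def orbitClosure {α : Type} [TopologicalSpace α] (w : ℕ → α) : Set (ℕ → α) :=
  closure (Set.range fun n => shift^[n] w)

/-- `w` is ultimately periodic: from some place on, it has a positive period. -/
def UltimatelyPeriodic {α : Type} (w : ℕ → α) : Prop :=
  ∃ n m, 0 < m ∧ ∀ k, n ≤ k → w (k + m) = w k

/-- Every factor of `w` occurs in `w` infinitely often, with bounded gaps. -/
def UniformlyRecurrent {α : Type} (w : ℕ → α) : Prop :=
  ∀ u, IsFactor u w → ∃ N, ∀ i, ∃ j, i ≤ j ∧ j < i + N ∧ OccursAt u w j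

/-- A morphism of the free monoid is given by the images `f x` of the letters;
this is its value on a finite word. -/
def onWords {α : Type} (f : α → List α) (u : List α) : List α := u.flatMap f

open Classical in
/-- The value of a morphism on an infinite word `u`: the `n`-th symbol is read off the image of any
prefix of `u` whose image is long enough (there is always one if no letter is erased). -/
noncomputable def onInfinite {α : Type} (f : α → List α) (u : ℕ → α) : ℕ → α := fun n =>
  if h : ∃ m, n < (onWords f (factorAt u 0 m)).length then
    (onWords f (factorAt u 0 h.choose))[n]'h.choose_spec
  else u 0

/-- `w` is the infinite word `lim fⁿ(x)`, where `x` is its first letter: all the words `fⁿ(x)` are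
prefixes of `w`, and their lengths are unbounded. (In particular `f x` starts with `x`.) -/
def IsPureMorphic {α : Type} (f : α → List α) (w : ℕ → α) : Prop :=
  (∀ n, OccursAt ((onWords f)^[n] [w 0]) w 0) ∧
    ∀ N, ∃ n, N ≤ ((onWords f)^[n] [w 0]).length

/-- `f` is order-preserving on the set `L` of infinite words, for the lexicographic order. -/
def OrderPreservingOn {α : Type} [LinearOrder α] (f : α → List α) (L : Set (ℕ → α)) : Prop :=
  ∀ u ∈ L, ∀ v ∈ L, toLex u < toLex v ↔ toLex (onInfinite f u) < toLex (onInfinite f v)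

/-- The two finite words are non-empty and end by different letters. -/
def EndDifferently {α : Type} (x y : List α) : Prop :=
  ∃ c ∈ x.getLast?, ∃ d ∈ y.getLast?, c ≠ d

/-! ### Types and separability -/

/-- `(u', p)` represents `u` as `σᵖ(f(u'))` with `u' ∈ L` and `0 ≤ p < |f(u'[0])|`. -/
def Represents {α : Type} (f : α → List α) (L : Set (ℕ → α)) (u : ℕ → α)
    (r : (ℕ → α) × ℕ) : Prop :=
  r.1 ∈ L ∧ r.2 < (f (r.1 0)).length ∧ u = shift^[r.2] (onInfinite f r.1)

/-- The possible types `(a, p)`, `0 ≤ p < |f(a)|`. -/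
abbrev PossibleType {α : Type} (f : α → List α) : Type :=
  {t : α × ℕ // t.2 < (f t.1).length}

/-- The type of `u` exists and is equal to `t`. -/
def HasType {α : Type} (f : α → List α) (L : Set (ℕ → α)) (u : ℕ → α) (t : PossibleType f) :
    Prop :=
  (∃! r, Represents f L u r) ∧ ∃ u', Represents f L u (u', t.1.2) ∧ u' 0 = t.1.1

/-- Every element of `L` has a type. -/
def Typable {α : Type} (f : α → List α) (L : Set (ℕ → α)) : Prop :=
  ∀ u ∈ L, ∃! r, Represents f L u r

/-- `L` is typable, and the possible types can be ordered consistently with the lexicographic order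
of the elements of `L`. -/
def Separable {α : Type} [LinearOrder α] (f : α → List α) (L : Set (ℕ → α)) : Prop :=
  Typable f L ∧ ∃ o : LinearOrder (PossibleType f), ∀ u ∈ L, ∀ v ∈ L, ∀ s t : PossibleType f,
    HasType f L u s → HasType f L v t → o.lt s t → toLex u < toLex v

/-! ### Synchronization -/

/-- Position `n` of the fixed point `w = f(w)` is a boundary between images of symbols. -/
def IsBoundary {α : Type} (f : α → List α) (w : ℕ → α) (n : ℕ) : Prop :=
  ∃ j, n = (onWords f (factorAt w 0 j)).length

/-- The place `k` in `u` is a synchronization point: in every occurrence of `u` in `w` there is a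
boundary between images of symbols at that place. (The ends of `u` are admitted.) -/
def IsSyncPoint {α : Type} (f : α → List α) (w : ℕ → α) (u : List α) (k : ℕ) : Prop :=
  k ≤ u.length ∧ ∀ i, OccursAt u w i → IsBoundary f w (i + k)

/-- `D` is a synchronization delay of the fixed point `w` of `f`: every factor of length at least
`D` has a synchronization point and contains all letters. -/
def IsSyncDelay {α : Type} (f : α → List α) (w : ℕ → α) (D : ℕ) : Prop :=
  0 < D ∧ ∀ u, IsFactor u w → D ≤ u.length → (∃ k, IsSyncPoint f w u k) ∧ ∀ x, x ∈ u

/-! ### The alphabet of factors of length `D` -/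

/-- The alphabet `A_D` of all factors of length `D` of a binary infinite word `w`. -/
def FactorAlphabet (w : ℕ → Fin 2) (D : ℕ) : Type :=
  {u : List (Fin 2) // IsFactor u w ∧ u.length = D}

/-- The lexicographic order inherited from `Fin 2`. -/
noncomputable instance (w : ℕ → Fin 2) (D : ℕ) : LinearOrder (FactorAlphabet w D) :=
  inferInstanceAs (LinearOrder {u : List (Fin 2) // IsFactor u w ∧ u.length = D})

/-- The (finite) alphabet is discrete. -/
instance (w : ℕ → Fin 2) (D : ℕ) : TopologicalSpace (FactorAlphabet w D) := ⊥

instance (w : ℕ → Fin 2) (D : ℕ) : DiscreteTopology (FactorAlphabet w D) := ⟨rfl⟩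

/-- The first symbol of a letter of `A_D` (for `D > 0`). -/
def rho {w : ℕ → Fin 2} {D : ℕ} (A : FactorAlphabet w D) : Fin 2 := A.1.headD 0

/-- `ρ` on infinite words, letter by letter. -/
def rhoWord {w : ℕ → Fin 2} {D : ℕ} (u : ℕ → FactorAlphabet w D) : ℕ → Fin 2 := fun n => rho (u n)

theorem IsFactor.of_infix {α : Type} {w : ℕ → α} {u v : List α} (hv : IsFactor v w)
    (h : u <:+: v) : IsFactor u w := by
  obtain ⟨i, hi⟩ := hv
  obtain ⟨s, t, rfl⟩ := h
  refine ⟨i + s.length, ?_⟩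
  unfold OccursAt factorAt at *
  apply List.ext_getElem
  · simp
  · intro n h1 h2
    have h3 := congrArg (fun l => l[s.length + n]?) hi
    have h4 : s.length + n < s.length + (u.length + t.length) := by omega
    simpa [h2, h4, add_assoc] using h3

theorem IsPureMorphic.isFactor_onWords {α : Type} {f : α → List α} {w : ℕ → α}
    (hw : IsPureMorphic f w) {u : List α} (hu : IsFactor u w) : IsFactor (onWords f u) w := by
  obtain ⟨i, hi⟩ := hu
  obtain ⟨n, hn⟩ := hw.2 (i + u.length)
  have hp : u <:+: (onWords f)^[n] [w 0] := by
    have h0 := hw.1 n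
    unfold OccursAt factorAt at *
    generalize (onWords f)^[n] [w 0] = v at *
    refine ⟨v.take i, v.drop (i + u.length), ?_⟩
    have h1 : u = (v.drop i).take u.length := by
      conv_lhs => rw [← hi]
      apply List.ext_getElem
      · simp; omega
      · intro k h1 h2
        simp at h1
        have h3 := congrArg (fun l => l[i + k]?) h0
        simp [show i + k < v.length by omega] at h3
        simpa using h3
    conv_lhs => rw [h1]
    rw [List.append_assoc]
    simp only [List.length_take, List.length_drop]
    rw [show min u.length (v.length - i) = u.length by omega, ← List.drop_drop,
      List.take_append_drop, List.take_append_drop]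
  obtain ⟨s, t, hst⟩ := hp
  refine IsFactor.of_infix (v := (onWords f)^[n + 1] [w 0]) ⟨0, hw.1 (n + 1)⟩ ?_
  rw [Function.iterate_succ_apply', ← hst]
  exact ⟨onWords f s, onWords f t, by simp [onWords]⟩

/-- The coding `π` of a factor `v` of `w` by the sequence of its successive factors of length `D`;
it has `|v| - D + 1` symbols if `|v| ≥ D`. -/
def piWord {w : ℕ → Fin 2} (D : ℕ) (v : List (Fin 2)) (hv : IsFactor v w) :
    List (FactorAlphabet w D) :=
  List.ofFn fun i : Fin (v.length + 1 - D) =>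
    ⟨(v.drop i).take D,
      hv.of_infix ((List.take_prefix _ _).isInfix.trans (List.drop_suffix _ _).isInfix),
      by simp; omega⟩

/-- The morphism `χ` on `A_D`: for `A = π(u)` with first symbol `x`, the image of `A` consists of
the first `|φ(x)|` symbols of `π(φ(u))`. -/
def chi (φ : Fin 2 → List (Fin 2)) (w : ℕ → Fin 2) (D : ℕ) (hw : IsPureMorphic φ w)
    (A : FactorAlphabet w D) : List (FactorAlphabet w D) :=
  (piWord D (onWords φ A.1) (hw.isFactor_onWords A.2.1)).take (φ (rho A)).length

end Morphic

open Morphic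

/-! Everything is transported along `ρ`. Call a word over `A_D` a coding if its letters are the
successive windows of length `D` of its `ρ`-image. If `y` codes `u`, then `χ(y)` codes `φ(u)`
(`IsCoding.onInfinite_val`), and codings compare lexicographically as their `ρ`-images do
(`IsCoding.lt_iff`). Fixed points of `χ` are codings (`IsPureMorphic.isCoding`), and by minimality
of `L_φ` the subshift `L_χ` consists exactly of the codings of elements of `L_φ`
(`mem_orbitClosure_chi_iff`). This yields order preservation, the bijections of fixed points and the
isomorphism.

The claims on last letters and separability rest on recognizability. When the images of letters end
differently, parsing leftwards from a boundary is forced. Hence the window of length `D` at the last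
letter of an image starts, inside images, only at last places (`marker`): a synchronization point
beyond the start of the window propagates left to the boundary after its first letter, and a
synchronization point at the very start is handled by `length_le_one_of_agree`. So the `φ`-type of a
word is visible in the stretch up to its first boundary and `D - 1` letters more
(`type_eq_of_agree`).

Two words of different `χ`-types either differ within that stretch, which their types determine, or
have the same `φ`-type. In the second case the offsets agree and the preimages differ among their
first `D` letters; as `φ` is strictly increasing or strictly decreasing on all infinite words
(`onInfinite_strictMono_or_strictAnti`), the types decide again (`lex_lt_of_same_types`). -/

namespace Morphic

/-! ### Infinite words, orbit closures and non-erasing morphisms over a general alphabet. -/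

section Words

variable {α : Type}

@[simp] theorem length_factorAt (w : ℕ → α) (i n : ℕ) : (factorAt w i n).length = n := by
  simp [factorAt]

@[simp] theorem getElem_factorAt (w : ℕ → α) (i n k : ℕ) (h : k < (factorAt w i n).length) :
    (factorAt w i n)[k] = w (i + k) := by
  simp [factorAt]

theorem factorAt_eq_factorAt_iff {u v : ℕ → α} {i j n : ℕ} :
    factorAt u i n = factorAt v j n ↔ ∀ k < n, u (i + k) = v (j + k) := by
  constructor
  · intro h k hk
    have := congrArg (fun l => l[k]?) h
    simpa [hk] using this
  · intro h
    apply List.ext_getElem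
    · simp
    · intro k h1 h2
      simpa using h k (by simpa using h1)

theorem factorAt_zero_succ (u : ℕ → α) (n : ℕ) :
    factorAt u 0 (n + 1) = u 0 :: factorAt (shift u) 0 n := by
  apply List.ext_getElem
  · simp
  · intro k h1 h2
    cases k <;> simp [shift]

theorem factorAt_add (u : ℕ → α) (i m n : ℕ) :
    factorAt u i (m + n) = factorAt u i m ++ factorAt u (i + m) n := by
  apply List.ext_getElem
  · simp
  · intro k h1 h2
    rw [List.getElem_append]
    split_ifs with h
    · simp
    · simp only [length_factorAt, not_lt, getElem_factorAt] at h ⊢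
      congr 1; omega

theorem occursAt_iff {u : List α} {w : ℕ → α} {i : ℕ} :
    OccursAt u w i ↔ ∀ (k : ℕ) (h : k < u.length), u[k] = w (i + k) := by
  constructor
  · intro h k hk
    have := congrArg (fun l => l[k]?) h
    simpa [hk] using this.symm
  · intro h
    apply List.ext_getElem
    · simp
    · intro k h1 h2
      simpa using (h k h2).symm

theorem OccursAt.of_prefix {u v : List α} {w : ℕ → α} {i : ℕ} (h : OccursAt v w i)
    (huv : u <+: v) : OccursAt u w i := by
  rw [occursAt_iff] at *
  intro k hk
  rw [← h k (hk.trans_le huv.length_le)]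
  exact huv.getElem hk

theorem occursAt_factorAt (w : ℕ → α) (i n : ℕ) : OccursAt (factorAt w i n) w i := by
  simp [OccursAt]

theorem isFactor_factorAt (w : ℕ → α) (i n : ℕ) : IsFactor (factorAt w i n) w :=
  ⟨i, occursAt_factorAt w i n⟩

theorem isFactor_factorAt_iff {u w : ℕ → α} {i n : ℕ} :
    IsFactor (factorAt u i n) w ↔ ∃ m, ∀ k < n, u (i + k) = w (m + k) := by
  simp only [IsFactor, occursAt_iff, length_factorAt, getElem_factorAt]

@[simp] theorem shift_iterate (u : ℕ → α) (j n : ℕ) : shift^[j] u n = u (j + n) := by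
  induction j generalizing u with
  | zero => simp
  | succ j ih => rw [Function.iterate_succ_apply, ih]; simp only [shift]; congr 1; omega

/-- For a discrete alphabet the cylinders over prefixes form a neighbourhood basis, so membership in
the subshift becomes a condition on finite prefixes. -/
theorem mem_orbitClosure_iff [TopologicalSpace α] [DiscreteTopology α] {u w : ℕ → α} :
    u ∈ orbitClosure w ↔ ∀ n, ∃ m, ∀ i < n, u i = w (m + i) := by
  unfold orbitClosure
  rw [mem_closure_iff_nhds]
  constructor
  · intro h n
    have hU : {v : ℕ → α | ∀ i < n, u i = v i} ∈ nhds u := by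
      have : {v : ℕ → α | ∀ i < n, u i = v i} = (Finset.range n : Set ℕ).pi fun i => {u i} := by
        ext v; simp [Set.mem_pi, eq_comm]
      rw [this]
      exact set_pi_mem_nhds (Finset.finite_toSet _) fun i _ => by simp
    obtain ⟨v, hv, m, rfl⟩ := h _ hU
    exact ⟨m, fun i hi => by simpa using hv i hi⟩
  · intro h U hU
    rw [nhds_pi, Filter.mem_pi] at hU
    obtain ⟨I, hI, t, ht, hsub⟩ := hU
    obtain ⟨N, hN⟩ := hI.bddAbove
    obtain ⟨m, hm⟩ := h (N + 1)
    refine ⟨shift^[m] w, hsub ?_, m, rfl⟩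
    intro i hi
    rw [shift_iterate, ← hm i (by have := hN hi; omega)]
    exact mem_of_mem_nhds (ht i)

theorem shift_mem_orbitClosure [TopologicalSpace α] [DiscreteTopology α] {u w : ℕ → α}
    (hu : u ∈ orbitClosure w) (j : ℕ) : shift^[j] u ∈ orbitClosure w := by
  rw [mem_orbitClosure_iff] at *
  intro n
  obtain ⟨m, hm⟩ := hu (j + n)
  exact ⟨m + j, fun i hi => by rw [shift_iterate, hm _ (by omega)]; congr 1; omega⟩

theorem self_mem_orbitClosure [TopologicalSpace α] (w : ℕ → α) : w ∈ orbitClosure w :=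
  subset_closure ⟨0, rfl⟩

theorem lex_lt_iff [LT α] {u v : ℕ → α} :
    toLex u < toLex v ↔ ∃ n, (∀ i < n, u i = v i) ∧ u n < v n := Iff.rfl

/-- The orbit closure of a uniformly recurrent word is minimal. -/
theorem UniformlyRecurrent.mem_orbitClosure_of_factors [TopologicalSpace α] [DiscreteTopology α]
    {u w y : ℕ → α} (hur : UniformlyRecurrent w) (hu : u ∈ orbitClosure w)
    (hy : y ∈ orbitClosure w) : y ∈ orbitClosure u := by
  rw [mem_orbitClosure_iff] at *
  intro n
  obtain ⟨m, hm⟩ := hy n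
  obtain ⟨N, hN⟩ := hur _ (isFactor_factorAt w m n)
  -- Some occurrence of the factor starts within `N` places of `a`; the additional `n` letters leave
  -- room for all of it.
  obtain ⟨a, ha⟩ := hu (N + n)
  obtain ⟨j, haj, hj, hocc⟩ := hN a
  refine ⟨j - a, fun i hi => ?_⟩
  rw [occursAt_iff] at hocc
  have := hocc i (by simpa using hi)
  rw [hm i hi, ha _ (by omega)]
  rw [getElem_factorAt] at this
  rw [this]; congr 1; omega

/-! ### Morphisms on infinite words -/

@[simp] theorem onWords_cons (f : α → List α) (x : α) (u : List α) :
    onWords f (x :: u) = f x ++ onWords f u := by simp [onWords]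

@[simp] theorem onWords_append (f : α → List α) (u v : List α) :
    onWords f (u ++ v) = onWords f u ++ onWords f v := by simp [onWords]

@[simp] theorem onWords_nil (f : α → List α) : onWords f [] = [] := rfl

theorem onWords_prefix (f : α → List α) {u v : List α} (h : u <+: v) :
    onWords f u <+: onWords f v := by
  obtain ⟨t, rfl⟩ := h
  simp

theorem onWords_iterate_prefix (f : α → List α) {u v : List α} (h : u <+: v) (n : ℕ) :
    (onWords f)^[n] u <+: (onWords f)^[n] v := by
  induction n with
  | zero => exact h
  | succ n ih => simp only [Function.iterate_succ_apply']; exact onWords_prefix f ih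

theorem factorAt_prefix (u : ℕ → α) (i : ℕ) {m n : ℕ} (h : m ≤ n) :
    factorAt u i m <+: factorAt u i n := by
  obtain ⟨k, rfl⟩ := Nat.exists_eq_add_of_le h
  rw [factorAt_add]
  exact List.prefix_append _ _

theorem onInfinite_eq_getElem (f : α → List α) (u : ℕ → α) {n m : ℕ}
    (h : n < (onWords f (factorAt u 0 m)).length) :
    onInfinite f u n = (onWords f (factorAt u 0 m))[n] := by
  have hex : ∃ m, n < (onWords f (factorAt u 0 m)).length := ⟨m, h⟩
  unfold onInfinite
  rw [dif_pos hex]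
  rcases le_total hex.choose m with hle | hle
  · exact (onWords_prefix f (factorAt_prefix u 0 hle)).getElem _
  · exact ((onWords_prefix f (factorAt_prefix u 0 hle)).getElem _).symm

/-- The length of the image of the prefix of length `j`. -/
def bdry (f : α → List α) (u : ℕ → α) (j : ℕ) : ℕ := (onWords f (factorAt u 0 j)).length

@[simp] theorem bdry_zero (f : α → List α) (u : ℕ → α) : bdry f u 0 = 0 := by
  simp [bdry, factorAt]

theorem bdry_succ (f : α → List α) (u : ℕ → α) (j : ℕ) :
    bdry f u (j + 1) = bdry f u j + (f (u j)).length := by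
  rw [bdry, factorAt_add, onWords_append, List.length_append, ← bdry]
  simp [factorAt]

theorem bdry_succ' (f : α → List α) (u : ℕ → α) (j : ℕ) :
    bdry f u (j + 1) = (f (u 0)).length + bdry f (shift u) j := by
  simp [bdry, factorAt_zero_succ]

theorem isBoundary_iff {f : α → List α} {w : ℕ → α} {n : ℕ} :
    IsBoundary f w n ↔ ∃ j, n = bdry f w j := Iff.rfl

theorem length_pos_of_nonErasing {f : α → List α} (hf : ∀ x, f x ≠ []) (x : α) :
    0 < (f x).length := List.length_pos_iff.2 (hf x)

theorem le_bdry {f : α → List α} (hf : ∀ x, f x ≠ []) (u : ℕ → α) (j : ℕ) : j ≤ bdry f u j := by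
  induction j with
  | zero => simp
  | succ j ih => rw [bdry_succ]; have := length_pos_of_nonErasing hf (u j); omega

theorem bdry_strictMono {f : α → List α} (hf : ∀ x, f x ≠ []) (u : ℕ → α) :
    StrictMono (bdry f u) :=
  strictMono_nat_of_lt_succ fun j => by
    rw [bdry_succ]; have := length_pos_of_nonErasing hf (u j); omega

theorem exists_bdry_add {f : α → List α} (hf : ∀ x, f x ≠ []) (u : ℕ → α) (n : ℕ) :
    ∃ j i, n = bdry f u j + i ∧ i < (f (u j)).length := by
  induction n with
  | zero => exact ⟨0, 0, by simp, length_pos_of_nonErasing hf _⟩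
  | succ n ih =>
    obtain ⟨j, i, h, hi⟩ := ih
    by_cases h2 : i + 1 < (f (u j)).length
    · exact ⟨j, i + 1, by omega, h2⟩
    · exact ⟨j + 1, 0, by rw [bdry_succ]; omega, length_pos_of_nonErasing hf _⟩

theorem onInfinite_of_lt (f : α → List α) (u : ℕ → α) {n : ℕ} (h : n < (f (u 0)).length) :
    onInfinite f u n = (f (u 0))[n] := by
  have h1 : onWords f (factorAt u 0 1) = f (u 0) := by simp [factorAt]
  rw [onInfinite_eq_getElem (m := 1) f u (by rwa [h1])]
  simp only [h1]

theorem onInfinite_add {f : α → List α} (hf : ∀ x, f x ≠ []) (u : ℕ → α) (n : ℕ) :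
    onInfinite f u ((f (u 0)).length + n) = onInfinite f (shift u) n := by
  have h1 : n < bdry f (shift u) (n + 1) := le_bdry hf _ (n + 1)
  rw [onInfinite_eq_getElem f (shift u) h1, onInfinite_eq_getElem (m := n + 2) f u
    (by change _ < bdry f u (n + 1 + 1); rw [bdry_succ']; omega)]
  simp only [factorAt_zero_succ u (n + 1), onWords_cons]
  rw [List.getElem_append_right (by omega)]
  simp only [Nat.add_sub_cancel_left]
  rfl

theorem onInfinite_bdry_add {f : α → List α} (hf : ∀ x, f x ≠ []) (u : ℕ → α) (j n : ℕ) :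
    onInfinite f u (bdry f u j + n) = onInfinite f (shift^[j] u) n := by
  induction j generalizing u with
  | zero => simp
  | succ j ih => rw [bdry_succ', add_assoc, onInfinite_add hf, ih, Function.iterate_succ_apply]

theorem onInfinite_bdry_add_of_lt {f : α → List α} (hf : ∀ x, f x ≠ []) (u : ℕ → α) {j n : ℕ}
    (h : n < (f (u j)).length) :
    onInfinite f u (bdry f u j + n) = (f (u j))[n] := by
  rw [onInfinite_bdry_add hf, onInfinite_of_lt f _ (by simpa using h)]
  simp

/-- Each of the `n` letters after the first contributes at least one symbol. With `n = D - 1` this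
says that `D` letters determine the first image and `D - 1` symbols beyond it. -/
theorem onInfinite_congr {f : α → List α} (hf : ∀ x, f x ≠ []) {u v : ℕ → α} {n : ℕ}
    (h : ∀ i < n + 1, u i = v i) :
    ∀ i < (f (u 0)).length + n, onInfinite f u i = onInfinite f v i := by
  induction n generalizing u v with
  | zero =>
    intro i hi
    have h0 := h 0 (by omega)
    rw [onInfinite_of_lt f u hi, onInfinite_of_lt f v (by rw [← h0]; exact hi)]
    simp only [h0]
  | succ n ih =>
    intro i hi
    have h0 := h 0 (by omega)
    rcases lt_or_ge i (f (u 0)).length with hlt | hge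
    · rw [onInfinite_of_lt f u hlt, onInfinite_of_lt f v (by rw [← h0]; exact hlt)]
      simp only [h0]
    · obtain ⟨k, rfl⟩ := Nat.exists_eq_add_of_le hge
      rw [onInfinite_add hf, h0, onInfinite_add hf]
      have := length_pos_of_nonErasing hf (u (0 + 1))
      rw [h0] at hi
      exact ih (fun i hi => h (i + 1) (by omega)) k (by omega)

theorem onInfinite_eq_of_agree {f : α → List α} (hf : ∀ x, f x ≠ []) {u v : ℕ → α} {n : ℕ}
    (h : ∀ i < n + 1, u i = v i) : onInfinite f u n = onInfinite f v n :=
  onInfinite_congr hf h n (by have := length_pos_of_nonErasing hf (u 0); omega)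

theorem bdry_congr {f : α → List α} {u v : ℕ → α} {j : ℕ} (h : ∀ i < j, u i = v i) :
    bdry f u j = bdry f v j := by
  unfold bdry
  rw [(factorAt_eq_factorAt_iff (i := 0) (j := 0)).2 (by simpa using h)]

theorem factorAt_onInfinite {f : α → List α} (u : ℕ → α) (m : ℕ) :
    factorAt (onInfinite f u) 0 (bdry f u m) = onWords f (factorAt u 0 m) := by
  apply List.ext_getElem
  · simp [bdry]
  · intro k h1 h2
    simp [onInfinite_eq_getElem f u h2]

theorem continuous_onInfinite [TopologicalSpace α] [DiscreteTopology α] {f : α → List α}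
    (hf : ∀ x, f x ≠ []) : Continuous (onInfinite f) := by
  refine continuous_pi fun n => continuous_iff_continuousAt.2 fun u => ?_
  refine (continuousAt_const (y := onInfinite f u n)).congr ?_
  have : (Finset.range (n + 1) : Set ℕ).pi (fun i => {u i}) ∈ nhds u :=
    set_pi_mem_nhds (Finset.finite_toSet _) fun i _ => by simp
  filter_upwards [this] with v hv
  exact onInfinite_eq_of_agree hf fun i hi => (hv i (by simpa using hi)).symm

theorem continuous_shift [TopologicalSpace α] : Continuous (shift : (ℕ → α) → ℕ → α) :=
  continuous_pi fun n => continuous_apply (n + 1)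

/-! ### Fixed points -/

theorem IsPureMorphic.occursAt_onWords {f : α → List α} {w : ℕ → α} (hw : IsPureMorphic f w)
    (m : ℕ) : OccursAt (onWords f (factorAt w 0 m)) w 0 := by
  obtain ⟨n, hn⟩ := hw.2 m
  refine (hw.1 (n + 1)).of_prefix ?_
  rw [Function.iterate_succ_apply']
  apply onWords_prefix
  rw [← hw.1 n]
  exact factorAt_prefix w 0 hn

theorem IsPureMorphic.exists_lt_bdry {f : α → List α} {w : ℕ → α} (hw : IsPureMorphic f w)
    (N : ℕ) : ∃ m, N < bdry f w m := by
  obtain ⟨n, hn⟩ := hw.2 (N + 2)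
  cases n with
  | zero => simp at hn
  | succ n =>
    refine ⟨((onWords f)^[n] [w 0]).length, ?_⟩
    unfold bdry
    rw [hw.1 n, ← Function.iterate_succ_apply' (onWords f)]
    exact Nat.lt_of_succ_lt hn

theorem IsPureMorphic.onInfinite_eq {f : α → List α} {w : ℕ → α} (hw : IsPureMorphic f w) :
    onInfinite f w = w := by
  funext n
  obtain ⟨m, hm⟩ := hw.exists_lt_bdry n
  rw [onInfinite_eq_getElem f w hm]
  simpa using occursAt_iff.1 (hw.occursAt_onWords m) n hm

theorem onWords_iterate_occursAt {f : α → List α} {u : ℕ → α} (hu : onInfinite f u = u) (n m : ℕ) :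
    OccursAt ((onWords f)^[n] (factorAt u 0 m)) u 0 := by
  induction n with
  | zero => exact occursAt_factorAt _ _ _
  | succ n ih =>
    rw [Function.iterate_succ_apply', ← ih, ← factorAt_onInfinite, hu]
    exact occursAt_factorAt _ _ _

theorem isPureMorphic_of_onInfinite_eq {f : α → List α} {u : ℕ → α} (hu : onInfinite f u = u)
    (h : ∀ N, ∃ n, N ≤ ((onWords f)^[n] [u 0]).length) : IsPureMorphic f u := by
  refine ⟨fun n => ?_, h⟩
  have := onWords_iterate_occursAt hu n 1
  simpa [factorAt] using this

theorem IsPureMorphic.ext {f : α → List α} {u v : ℕ → α} (hu : IsPureMorphic f u)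
    (hv : IsPureMorphic f v) (h : u 0 = v 0) : u = v := by
  funext k
  obtain ⟨n, hn⟩ := hu.2 (k + 1)
  have h1 := occursAt_iff.1 (hu.1 n) k hn
  have h2 := occursAt_iff.1 (hv.1 n) k (by rw [← h]; exact hn)
  simp only [zero_add] at h1 h2
  rw [← h1, ← h2]
  simp only [h]

theorem onInfinite_mem_orbitClosure [TopologicalSpace α] [DiscreteTopology α]
    {f : α → List α} (hf : ∀ x, f x ≠ []) {u w : ℕ → α} (hw : onInfinite f w = w)
    (hu : u ∈ orbitClosure w) : onInfinite f u ∈ orbitClosure w := by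
  rw [mem_orbitClosure_iff] at *
  intro n
  obtain ⟨m, hm⟩ := hu n
  refine ⟨bdry f w m, fun i hi => ?_⟩
  rw [← congrFun hw (bdry f w m + i), onInfinite_bdry_add hf]
  exact onInfinite_eq_of_agree hf fun k hk => by rw [hm k (by omega), shift_iterate]

/-- Every element of the subshift of a fixed point can be desubstituted. -/
theorem exists_represents [TopologicalSpace α] [DiscreteTopology α] [Finite α]
    {f : α → List α} (hf : ∀ x, f x ≠ []) {u w : ℕ → α} (hw : onInfinite f w = w)
    (hu : u ∈ orbitClosure w) : ∃ r, Represents f (orbitClosure w) u r := by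
  -- `K` is the set of all representable words. It is a finite union of continuous images of compact
  -- sets, hence closed, so it is enough to represent the words of the orbit of `w`.
  set K : Set (ℕ → α) := ⋃ x : α, ⋃ p : Fin (f x).length,
    (fun v => shift^[p] (onInfinite f v)) '' (orbitClosure w ∩ {v | v 0 = x}) with hK
  have hcomp : IsCompact K := by
    refine isCompact_iUnion fun x => isCompact_iUnion fun p => IsCompact.image ?_ ?_
    · exact (isClosed_closure.inter
        (isClosed_singleton.preimage (continuous_apply 0))).isCompact
    · exact (continuous_shift.iterate p).comp (continuous_onInfinite hf)
  have hsub : orbitClosure w ⊆ K := by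
    refine closure_minimal ?_ hcomp.isClosed
    rintro _ ⟨n, rfl⟩
    obtain ⟨j, i, rfl, hi⟩ := exists_bdry_add hf w n
    simp only [hK, Set.mem_iUnion]
    refine ⟨w j, ⟨i, hi⟩, shift^[j] w, ⟨shift_mem_orbitClosure (self_mem_orbitClosure w) j,
      by simp⟩, ?_⟩
    funext k
    simp only [shift_iterate]
    rw [← onInfinite_bdry_add hf, hw, add_assoc]
  have := hsub hu
  simp only [hK, Set.mem_iUnion] at this
  obtain ⟨x, p, v, ⟨hv, rfl⟩, rfl⟩ := this
  exact ⟨(v, p), hv, p.2, rfl⟩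

end Words
-- Binary morphisms: non-erasure, recognizability, monotonicity.
section Binary

theorem getElem_flatten_replicate_add {α : Type} (s : List α) (r k : ℕ)
    (h : k + s.length < (List.replicate r s).flatten.length) :
    (List.replicate r s).flatten[k + s.length] = (List.replicate r s).flatten[k] := by
  cases r with
  | zero => simp at h
  | succ r =>
    have h1 : (List.replicate (r + 1) s).flatten = s ++ (List.replicate r s).flatten := by
      simp [List.replicate_succ]
    have h2 : (List.replicate (r + 1) s).flatten = (List.replicate r s).flatten ++ s := by
      simp [List.replicate_succ']
    have h3 : k < (List.replicate r s).flatten.length := by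
      rw [h1, List.length_append] at h; omega
    have e1 : (List.replicate (r + 1) s).flatten[k + s.length] =
        (List.replicate r s).flatten[k] := by
      simp only [h1]
      rw [List.getElem_append_right (by omega)]
      simp
    have e2 : (List.replicate (r + 1) s).flatten[k] = (List.replicate r s).flatten[k] := by
      simp only [h2]
      rw [List.getElem_append_left h3]
    rw [e1, e2]

/-- If one letter were erased, every image would be a power of the image of the other letter, and
`w` would be periodic. -/
theorem IsPureMorphic.nonErasing {φ : Fin 2 → List (Fin 2)} {w : ℕ → Fin 2}
    (hw : IsPureMorphic φ w) (hap : ¬ UltimatelyPeriodic w) (x : Fin 2) : φ x ≠ [] := by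
  intro hx
  have hrep : ∀ v : List (Fin 2), ∃ r, onWords φ v = (List.replicate r (φ (1 - x))).flatten := by
    have : ∀ x y : Fin 2, y = x ∨ y = 1 - x := by decide
    intro v
    induction v with
    | nil => exact ⟨0, by simp⟩
    | cons y v ih =>
      obtain ⟨r, hr⟩ := ih
      rcases this x y with rfl | rfl
      · exact ⟨r, by simp [hx, hr]⟩
      · exact ⟨r + 1, by simp [List.replicate_succ, hr]⟩
  refine hap ⟨0, (φ (1 - x)).length, ?_, fun k _ => ?_⟩
  · obtain ⟨m, hm⟩ := hw.exists_lt_bdry 0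
    obtain ⟨r, hr⟩ := hrep (factorAt w 0 m)
    rw [bdry, hr] at hm
    by_contra h0
    simp [List.eq_nil_of_length_eq_zero (Nat.eq_zero_of_not_pos h0)] at hm
  · obtain ⟨m, hm⟩ := hw.exists_lt_bdry (k + (φ (1 - x)).length)
    obtain ⟨r, hr⟩ := hrep (factorAt w 0 m)
    rw [bdry, hr] at hm
    have hocc := hw.occursAt_onWords m
    rw [hr, occursAt_iff] at hocc
    have h1 := hocc _ hm
    have h2 := hocc k (by omega)
    rw [zero_add] at h1 h2
    rw [← h1, ← h2, getElem_flatten_replicate_add _ _ _ hm]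

theorem EndDifferently.injective_getLast? {φ : Fin 2 → List (Fin 2)}
    (h : EndDifferently (φ 0) (φ 1)) : Function.Injective fun x => (φ x).getLast? := by
  obtain ⟨c, hc, d, hd, hcd⟩ := h
  simp only [Option.mem_def] at hc hd
  intro x y hxy
  simp only at hxy
  have : ∀ z : Fin 2, z = 0 ∨ z = 1 := by decide
  rcases this x with rfl | rfl <;> rcases this y with rfl | rfl
  · rfl
  · rw [hc, hd] at hxy; simp_all
  · rw [hc, hd] at hxy; simp_all
  · rfl

/-! ### Markers and recognizability. -/

section Parsing

variable {φ : Fin 2 → List (Fin 2)} {w : ℕ → Fin 2} {D : ℕ}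

/-- Images of letters are determined by their last letters, read off an infinite word. -/
theorem eq_of_last_eq {α : Type} {f : α → List α} (hf : ∀ x, f x ≠ [])
    (hend : Function.Injective fun x => (f x).getLast?) {u v : ℕ → α} {j k : ℕ}
    (h : onInfinite f u (bdry f u (j + 1) - 1) = onInfinite f v (bdry f v (k + 1) - 1)) :
    u j = v k := by
  have key : ∀ (u : ℕ → α) (j : ℕ),
      (f (u j)).getLast? = some (onInfinite f u (bdry f u (j + 1) - 1)) := by
    intro u j
    have := length_pos_of_nonErasing hf (u j)
    rw [bdry_succ, Nat.add_sub_assoc this, onInfinite_bdry_add_of_lt hf u (by omega),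
      List.getLast?_eq_getElem?, List.getElem?_eq_getElem]
  apply hend
  simp only [key, h]

/-- Parsing leftwards from a boundary is deterministic if images end by different letters. -/
theorem isBoundary_of_agree {α : Type} {f : α → List α} (hf : ∀ x, f x ≠ [])
    (hend : Function.Injective fun x => (f x).getLast?) {w : ℕ → α} (hw : onInfinite f w = w)
    (n : ℕ) {P Q : ℕ} (hP : IsBoundary f w P) (hPn : IsBoundary f w (P + n))
    (hQn : IsBoundary f w (Q + n)) (h : ∀ i < n, w (P + i) = w (Q + i)) : IsBoundary f w Q := by
  simp only [isBoundary_iff] at *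
  obtain ⟨p, hp⟩ := hP
  induction n using Nat.strong_induction_on with
  | _ n ih =>
    obtain rfl | hn := Nat.eq_zero_or_pos n
    · exact hQn
    obtain ⟨j, hj⟩ := hPn
    obtain ⟨k, hk⟩ := hQn
    cases j with
    | zero => simp at hj; omega
    | succ j =>
    cases k with
    | zero => simp at hk; omega
    | succ k =>
    have hlet : w j = w k := by
      apply eq_of_last_eq hf hend
      rw [← hj, ← hk, hw, Nat.add_sub_assoc hn, Nat.add_sub_assoc hn]
      exact h _ (by omega)
    -- The last image starts no earlier than `P`, so removing it leaves a shorter stretch still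
    -- beginning at `P`.
    have hpj : p ≤ j := by
      have : bdry f w p < bdry f w (j + 1) := by omega
      have := (bdry_strictMono hf w).lt_iff_lt.1 this
      omega
    have hle := (bdry_strictMono hf w).monotone hpj
    have hpos := length_pos_of_nonErasing hf (w j)
    rw [bdry_succ] at hj hk
    rw [← hlet] at hk
    exact ih (n - (f (w j)).length) (by omega)
      (fun i hi => h i (by omega)) ⟨j, by omega⟩ ⟨k, by omega⟩

/-- The exceptional case of the marker property, where a marker is only synchronized at its
beginning: then one letter has an image of length one. -/
theorem length_le_one_of_agree (hne : ∀ x, φ x ≠ []) (hw : IsPureMorphic φ w)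
    (hend : Function.Injective fun x => (φ x).getLast?) (hD : IsSyncDelay φ w D) {j k : ℕ}
    (hlen : (φ (w j)).length = 1)
    (h : ∀ t < D, w (bdry φ w j + t) = w (bdry φ w k + t)) : (φ (w k)).length = 1 := by
  have hfix := hw.onInfinite_eq
  by_contra hk
  have hpos := length_pos_of_nonErasing hne (w k)
  have hD0 := hD.1
  have first : ∀ l, ∃ h0 : 0 < (φ (w l)).length, w (bdry φ w l) = (φ (w l))[0] := fun l =>
    ⟨length_pos_of_nonErasing hne _, by
      have := onInfinite_bdry_add_of_lt hne w (length_pos_of_nonErasing hne (w l))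
      rwa [hfix, add_zero] at this⟩
  have hxy : w j ≠ w k := fun e => hk (e ▸ hlen)
  set x := w j with hx
  set y := w k with hy
  have two : ∀ z, z = x ∨ z = y := by
    have : ∀ x y z : Fin 2, x ≠ y → z = x ∨ z = y := by decide
    exact fun z => this x y z hxy
  have hc : w (bdry φ w j) = w (bdry φ w k) := by simpa using h 0 hD0
  -- the first letter of `w` has a growing image
  have hw0 : w 0 = y := by
    -- Otherwise `φ x = [x]` and the iterates on the first letter of `w` would not grow.
    refine (two (w 0)).resolve_left fun e => ?_
    have h1 : φ x = [x] := by
      obtain ⟨c, hc⟩ := List.length_eq_one_iff.1 hlen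
      have := first 0
      simp only [bdry_zero, e, hc] at this
      obtain ⟨_, h⟩ := this
      rw [hc]; simpa using h.symm
    have h2 : ∀ n, (onWords φ)^[n] [w 0] = [x] := by
      intro n
      rw [e]
      induction n with
      | zero => rfl
      | succ n ih => rw [Function.iterate_succ_apply', ih]; simp [h1]
    obtain ⟨n, hn⟩ := hw.2 2
    rw [h2] at hn
    simp at hn
  have hyy : w (bdry φ w k) = y := by
    obtain ⟨_, h1⟩ := first k
    obtain ⟨_, h2⟩ := first 0
    simp only [bdry_zero, hw0] at h2
    rw [h1, h2]
  have hxim : φ x = [y] := by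
    obtain ⟨c, hc'⟩ := List.length_eq_one_iff.1 hlen
    obtain ⟨_, h1⟩ := first j
    simp only [← hx, hc'] at h1
    rw [hc', ← hyy, ← hc, h1]
    simp
  -- Since `φ x = [y]`, the image of `y` must end by the other letter.
  have hylast : onInfinite φ w (bdry φ w (k + 1) - 1) = x := by
    refine (two _).resolve_right fun e => hxy ?_
    apply eq_of_last_eq hne hend (u := w) (v := w)
    rw [e, hfix, bdry_succ, ← hx, hlen, Nat.add_sub_cancel, hc, hyy]
  -- the first occurrence of `x`
  have hex : ∃ t, t < D ∧ w (bdry φ w k + t) = x := by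
    have hmem := (hD.2 _ (isFactor_factorAt w (bdry φ w k) D) (by simp)).2 x
    obtain ⟨t, ht, he⟩ := List.getElem_of_mem hmem
    exact ⟨t, by simpa using ht, by simpa using he⟩
  classical
  obtain ⟨htD, htx⟩ := Nat.find_spec hex
  have hmin : ∀ i < Nat.find hex, w (bdry φ w k + i) = y := fun i hi =>
    (two _).resolve_left fun e => Nat.find_min hex hi ⟨by omega, e⟩
  set t := Nat.find hex with ht
  have htle : t < (φ y).length := by
    by_contra hcon
    have := hmin ((φ y).length - 1) (by omega)
    rw [hfix, bdry_succ, Nat.add_sub_assoc hpos] at hylast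
    exact hxy (hylast.symm.trans this)
  have hyim : ∀ (i : ℕ) (h : i < (φ y).length), i < t → (φ y)[i] = y := by
    intro i h hi
    refine Eq.trans ?_ (hmin i hi)
    have := onInfinite_bdry_add_of_lt hne w (j := k) h
    rw [hfix] at this
    exact this.symm
  -- Every boundary is followed by `t` letters `y`: the image of `y` supplies them all, while the
  -- image of `x` supplies one and leaves the rest to the next boundary.
  have hall : ∀ i < t, ∀ l, w (bdry φ w l + i) = y := by
    intro i
    induction i with
    | zero =>
      intro hi l
      obtain ⟨h0, h1⟩ := first l
      rw [add_zero, h1]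
      rcases two (w l) with e | e
      · simp [e, hxim]
      · simp only [e]; exact hyim 0 _ hi
    | succ i ih =>
      intro hi l
      rcases two (w l) with e | e
      · rw [add_comm i 1, ← add_assoc]
        have := bdry_succ φ w l
        rw [e, hlen] at this
        rw [← this]
        exact ih (by omega) (l + 1)
      · have hlt : i + 1 < (φ (w l)).length := by rw [e]; omega
        have := onInfinite_bdry_add_of_lt hne w hlt
        rw [hfix] at this
        rw [this]
        simp only [e]
        exact hyim _ _ hi
  have ht0 : t ≠ 0 := by
    intro h0
    rw [h0, add_zero, hyy] at htx
    exact hxy htx.symm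
  -- The image at `j` is the single letter `y`, so `y` stands `t` places after the boundary there,
  -- where the assumed agreement puts `x`.
  have h1 := hall (t - 1) (by omega) (j + 1)
  rw [bdry_succ, ← hx, hlen, add_assoc, show 1 + (t - 1) = t by omega, h t htD, htx] at h1
  exact hxy h1

/-- The factor of length `D` beginning at the last letter of an image of a letter occurs, in images
of letters, only at last places. -/
theorem marker_self (hne : ∀ x, φ x ≠ []) (hw : IsPureMorphic φ w)
    (hend : Function.Injective fun x => (φ x).getLast?) (hD : IsSyncDelay φ w D) {j k i : ℕ}
    (hi : i < (φ (w k)).length)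
    (h : ∀ t < D, w (bdry φ w (j + 1) - 1 + t) = w (bdry φ w k + i + t)) :
    i + 1 = (φ (w k)).length := by
  have hfix := hw.onInfinite_eq
  have hpos := length_pos_of_nonErasing hne (w j)
  obtain ⟨s, hs, hsync⟩ := (hD.2 _ (isFactor_factorAt w (bdry φ w (j + 1) - 1) D) (by simp)).1
  rw [length_factorAt] at hs
  have hP := hsync _ (occursAt_factorAt _ _ _)
  have hQ := hsync (bdry φ w k + i) (by
    rw [occursAt_iff]; intro t ht; simpa using h t (by simpa using ht))
  have hb := bdry_succ φ w j
  have between : ∀ l m, bdry φ w l < m → m < bdry φ w (l + 1) → ¬ IsBoundary φ w m := by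
    rintro l m h1 h2 ⟨r, hr⟩
    change m = bdry φ w r at hr
    rw [hr] at h1 h2
    have h3 := (bdry_strictMono hne w).lt_iff_lt.1 h1
    have h4 := (bdry_strictMono hne w).lt_iff_lt.1 h2
    omega
  have hbk := bdry_succ φ w k
  -- With `s = 0` both windows start at boundaries, which forces the offset `i` to vanish and the
  -- image at `j` to be a single letter. With `s > 0`, parse left from the synchronization point to
  -- the boundary after the first letter of the window.
  cases s with
  | zero =>
    have hi0 : i = 0 := by
      by_contra hi0
      exact between k _ (by omega) (by omega) hQ
    have hj1 : (φ (w j)).length = 1 := by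
      by_contra hj1
      exact between j _ (by omega) (by omega) hP
    subst hi0
    have := length_le_one_of_agree hne hw hend hD hj1 (k := k) (by
      intro t ht
      have := h t ht
      rwa [hb, hj1, Nat.add_sub_cancel, add_zero] at this)
    omega
  | succ s =>
    by_contra hcon
    refine between k (bdry φ w k + i + 1) (by omega) (by omega) ?_
    refine isBoundary_of_agree hne hend hfix s (P := bdry φ w (j + 1)) ⟨j + 1, rfl⟩ ?_ ?_ ?_
    · convert hP using 1; omega
    · convert hQ using 1; omega
    · intro t ht
      have := h (t + 1) (by omega)
      convert this using 2 <;> omega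

/-- Only the first image and `D - 1` symbols beyond it are inspected, and these depend on the first
`D` letters of the argument. As those form factors of `w`, both words may be replaced by shifts of
`w`, where `marker_self` applies. -/
theorem marker (hne : ∀ x, φ x ≠ []) (hw : IsPureMorphic φ w)
    (hend : Function.Injective fun x => (φ x).getLast?) (hD : IsSyncDelay φ w D)
    {μ ν : ℕ → Fin 2} (hμ : IsFactor (factorAt μ 0 D) w) (hν : IsFactor (factorAt ν 0 D) w)
    {i : ℕ} (hi : i < (φ (ν 0)).length)
    (h : ∀ t < D, onInfinite φ μ ((φ (μ 0)).length - 1 + t) = onInfinite φ ν (i + t)) :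
    i + 1 = (φ (ν 0)).length := by
  have hfix := hw.onInfinite_eq
  have hD0 := hD.1
  rw [isFactor_factorAt_iff] at hμ hν
  obtain ⟨j, hj⟩ := hμ
  obtain ⟨k, hk⟩ := hν
  simp only [zero_add] at hj hk
  obtain ⟨E, rfl⟩ := Nat.exists_eq_add_of_le' hD0
  have hμ' := onInfinite_congr hne (u := μ) (v := shift^[j] w) (n := E) (by simpa using hj)
  have hν' := onInfinite_congr hne (u := ν) (v := shift^[k] w) (n := E) (by simpa using hk)
  have hj0 := hj 0 (by omega)
  have hk0 := hk 0 (by omega)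
  rw [add_zero] at hj0 hk0
  have hpos := length_pos_of_nonErasing hne (w j)
  simp only [← onInfinite_bdry_add hne, hfix, hj0, hk0] at hμ' hν'
  simp only [hj0, hk0] at h hi ⊢
  refine marker_self hne hw hend hD (j := j) hi fun t ht => ?_
  rw [bdry_succ, Nat.add_sub_assoc hpos, add_assoc, add_assoc, ← hμ' _ (by omega),
    ← hν' _ (by omega)]
  exact h t ht

/-- Recognizability: the type of a word is determined by a short prefix. -/
theorem type_eq_of_agree (hne : ∀ x, φ x ≠ []) (hw : IsPureMorphic φ w)
    (hend : Function.Injective fun x => (φ x).getLast?) (hD : IsSyncDelay φ w D)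
    {μ ν : ℕ → Fin 2} (hμ : IsFactor (factorAt μ 0 D) w) (hν : IsFactor (factorAt ν 0 D) w)
    {p q : ℕ} (hp : p < (φ (μ 0)).length) (hq : q < (φ (ν 0)).length)
    (h : ∀ t < min ((φ (μ 0)).length - p) ((φ (ν 0)).length - q) + (D - 1),
      onInfinite φ μ (p + t) = onInfinite φ ν (q + t)) : μ 0 = ν 0 ∧ p = q := by
  wlog hle : (φ (μ 0)).length - p ≤ (φ (ν 0)).length - q generalizing μ ν p q
  · have := this hν hμ hq hp (fun t ht => (h t (by rwa [min_comm])).symm) (by omega)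
    exact ⟨this.1.symm, this.2.symm⟩
  rw [min_eq_left hle] at h
  have hD0 := hD.1
  -- This place in the image of `ν 0` is aligned with the last letter of the image of `μ 0`. The
  -- marker makes it a last place too, so both remainders have the same length and the same last
  -- letter.
  have hm := marker hne hw hend hD hμ hν (i := q + ((φ (μ 0)).length - p - 1)) (by omega) (by
    intro t ht
    have := h ((φ (μ 0)).length - p - 1 + t) (by omega)
    convert this using 2 <;> omega)
  have h0 : μ 0 = ν 0 := by
    apply eq_of_last_eq hne hend
    have := h ((φ (μ 0)).length - p - 1) (by omega)
    simp only [bdry_succ, bdry_zero]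
    convert this using 2 <;> omega
  refine ⟨h0, ?_⟩
  rw [h0] at hm hp
  omega

theorem IsFactor.of_mem_orbitClosure {u : ℕ → Fin 2} (hu : u ∈ orbitClosure w) (i n : ℕ) :
    IsFactor (factorAt u i n) w := by
  rw [isFactor_factorAt_iff]
  obtain ⟨m, hm⟩ := mem_orbitClosure_iff.1 (shift_mem_orbitClosure hu i) n
  exact ⟨m, by simpa using hm⟩

/-- Uniqueness of representations. -/
theorem represents_unique (hne : ∀ x, φ x ≠ []) (hw : IsPureMorphic φ w)
    (hend : Function.Injective fun x => (φ x).getLast?) (hD : IsSyncDelay φ w D)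
    {μ ν : ℕ → Fin 2} (hμ : μ ∈ orbitClosure w) (hν : ν ∈ orbitClosure w) {p q : ℕ}
    (hp : p < (φ (μ 0)).length) (hq : q < (φ (ν 0)).length)
    (h : shift^[p] (onInfinite φ μ) = shift^[q] (onInfinite φ ν)) : μ = ν ∧ p = q := by
  have step : ∀ {μ ν : ℕ → Fin 2}, μ ∈ orbitClosure w → ν ∈ orbitClosure w → ∀ {p q : ℕ},
      p < (φ (μ 0)).length → q < (φ (ν 0)).length →
      shift^[p] (onInfinite φ μ) = shift^[q] (onInfinite φ ν) → μ 0 = ν 0 ∧ p = q := by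
    intro μ ν hμ hν p q hp hq h
    refine type_eq_of_agree hne hw hend hD (.of_mem_orbitClosure hμ 0 D)
      (.of_mem_orbitClosure hν 0 D) hp hq fun t _ => ?_
    simpa using congrFun h t
  refine ⟨?_, (step hμ hν hp hq h).2⟩
  funext n
  induction n generalizing μ ν p q with
  | zero => exact (step hμ hν hp hq h).1
  | succ n ih =>
    obtain ⟨h0, rfl⟩ := step hμ hν hp hq h
    -- Once the common first image is cut off, both words continue from a boundary.
    refine ih (μ := shift μ) (ν := shift ν) (p := 0) (q := 0) (shift_mem_orbitClosure hμ 1)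
      (shift_mem_orbitClosure hν 1) (length_pos_of_nonErasing hne _)
      (length_pos_of_nonErasing hne _) ?_
    funext m
    simp only [Function.iterate_zero, id]
    rw [← onInfinite_add hne, ← onInfinite_add hne, ← h0]
    have := congrFun h ((φ (μ 0)).length - p + m)
    simp only [shift_iterate] at this
    convert this using 2 <;> omega

end Parsing

/-! ### Binary morphisms preserve or reverse the order -/

/-- Images of infinite words agree up to a place where the first letter of the argument can be
read off. -/
theorem exists_common_prefix {φ : Fin 2 → List (Fin 2)} (hne : ∀ x, φ x ≠ [])
    (hend : Function.Injective fun x => (φ x).getLast?) :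
    ∃ (m : ℕ) (z : ℕ → Fin 2) (α : Fin 2 → Fin 2), α 0 ≠ α 1 ∧
      ∀ u, (∀ i < m, onInfinite φ u i = z i) ∧ onInfinite φ u m = α (u 0) := by
  -- The alternating words serve as test words: shifting one gives the other. Their images differ,
  -- since `φ(01)` and `φ(10)` have equal lengths and different last letters; `m` will be the first
  -- difference.
  set alt : Fin 2 → ℕ → Fin 2 := fun x n => if Even n then x else 1 - x with halt
  have hshift : ∀ x, shift (alt x) = alt (1 - x) := by
    intro x
    funext n
    simp only [halt, shift, Nat.even_add_one]
    by_cases h : Even n <;> simp [h]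
  set F : Fin 2 → ℕ → Fin 2 := fun x => onInfinite φ (alt x) with hF
  have alt0 : ∀ x, alt x 0 = x := fun x => by simp [halt]
  have Flt : ∀ x u n, u 0 = x → n < (φ x).length → onInfinite φ u n = F x n := by
    intro x u n hu hn
    subst hu
    simp only [hF]
    rw [onInfinite_of_lt φ u hn, onInfinite_of_lt φ _ (by rwa [alt0])]
    simp only [alt0]
  have Fadd : ∀ x n, F x ((φ x).length + n) = F (1 - x) n := by
    intro x n
    simp only [hF]
    rw [← hshift, ← onInfinite_add hne, alt0]
  have hdiff : ∃ m, F 0 m ≠ F 1 m := by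
    by_contra! hcon
    have h1 := hcon ((φ 0).length + ((φ 1).length - 1))
    have p0 := length_pos_of_nonErasing hne 0
    have p1 := length_pos_of_nonErasing hne 1
    rw [Fadd, show (φ 0).length + ((φ 1).length - 1) = (φ 1).length + ((φ 0).length - 1) by omega,
      Fadd] at h1
    have h2 : alt 1 0 = alt 0 0 := by
      apply eq_of_last_eq hne hend
      simp only [bdry_succ, bdry_zero, alt0, zero_add]
      simpa using h1
    simp [alt0] at h2
  classical
  have hmin : ∀ i < Nat.find hdiff, F 0 i = F 1 i := fun i hi => by
    simpa using Nat.find_min hdiff hi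
  have hm := Nat.find_spec hdiff
  set m := Nat.find hdiff
  have two : ∀ z : Fin 2, z = 0 ∨ z = 1 := by decide
  have hall : ∀ x, ∀ i < m, F x i = F 0 i := by
    intro x i hi
    rcases two x with rfl | rfl
    · rfl
    · exact (hmin i hi).symm
  have hagree : ∀ i < m, ∀ u, onInfinite φ u i = F 0 i := by
    intro i
    induction i using Nat.strong_induction_on with
    | _ i ih =>
      intro hi u
      rcases lt_or_ge i (φ (u 0)).length with hlt | hge
      · rw [Flt _ u i rfl hlt, hall _ i hi]
      · obtain ⟨k, rfl⟩ := Nat.exists_eq_add_of_le hge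
        have := length_pos_of_nonErasing hne (u 0)
        rw [onInfinite_add hne, ih k (by omega) (by omega), ← hall (u 0) _ hi, Fadd,
          hall (1 - u 0) _ (by omega)]
  refine ⟨m, F 0, fun x => F x m, hm, fun u => ⟨fun i hi => hagree i hi u, ?_⟩⟩
  rcases lt_or_ge m (φ (u 0)).length with hlt | hge
  · rw [Flt _ u m rfl hlt]
  · obtain ⟨k, hk⟩ := Nat.exists_eq_add_of_le hge
    have := length_pos_of_nonErasing hne (u 0)
    change _ = F (u 0) m
    rw [hk, onInfinite_add hne, Fadd, hagree _ (by omega), hall (1 - u 0) _ (by omega)]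

/-- Past the image of the common prefix come `m` further common symbols, and then `α 0` against `α
1`. The direction depends only on how these two compare. -/
theorem onInfinite_strictMono_or_strictAnti {φ : Fin 2 → List (Fin 2)} (hne : ∀ x, φ x ≠ [])
    (hend : Function.Injective fun x => (φ x).getLast?) :
    (∀ u v : ℕ → Fin 2, toLex u < toLex v →
        toLex (onInfinite φ u) < toLex (onInfinite φ v)) ∨
      ∀ u v : ℕ → Fin 2, toLex u < toLex v →
        toLex (onInfinite φ v) < toLex (onInfinite φ u) := by
  obtain ⟨m, z, α, hα, hz⟩ := exists_common_prefix hne hend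
  have key : ∀ (u v : ℕ → Fin 2) (n : ℕ), (∀ i < n, u i = v i) → u n < v n →
      ∃ N, (∀ i < N, onInfinite φ u i = onInfinite φ v i) ∧
        onInfinite φ u N = α 0 ∧ onInfinite φ v N = α 1 := by
    intro u v n hn hlt
    have hb := bdry_congr (f := φ) hn
    have h01 : u n = 0 ∧ v n = 1 := by
      have : ∀ x y : Fin 2, x < y → x = 0 ∧ y = 1 := by decide
      exact this _ _ hlt
    refine ⟨bdry φ u n + m, fun i hi => ?_, ?_, ?_⟩
    · rcases lt_or_ge i (bdry φ u n) with h | h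
      · rw [onInfinite_eq_getElem φ u h, onInfinite_eq_getElem φ v (hb ▸ h)]
        have : factorAt u 0 n = factorAt v 0 n := factorAt_eq_factorAt_iff.2 (by simpa using hn)
        simp only [this]
        rfl
      · obtain ⟨k, rfl⟩ := Nat.exists_eq_add_of_le h
        conv_rhs => rw [hb]
        rw [onInfinite_bdry_add hne, onInfinite_bdry_add hne, (hz _).1 k (by omega),
          (hz _).1 k (by omega)]
    · rw [onInfinite_bdry_add hne, (hz _).2]; simp [h01.1]
    · rw [hb, onInfinite_bdry_add hne, (hz _).2]; simp [h01.2]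
  rcases lt_or_gt_of_ne hα with h | h
  · left
    rintro u v ⟨n, hn, hlt⟩
    obtain ⟨N, h1, h2, h3⟩ := key u v n hn hlt
    exact ⟨N, h1, by simpa [h2, h3] using h⟩
  · right
    rintro u v ⟨n, hn, hlt⟩
    obtain ⟨N, h1, h2, h3⟩ := key u v n hn hlt
    exact ⟨N, fun i hi => (h1 i hi).symm, by simpa [h2, h3] using h⟩

end Binary
-- Codings by windows of length `D`, and the action of `χ` on them.
section Coding

variable {φ : Fin 2 → List (Fin 2)} {w : ℕ → Fin 2} {D : ℕ}

instance : Finite (FactorAlphabet w D) :=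
  ((List.finite_length_eq (Fin 2) D).subset fun _ h => h.2 :
    {u : List (Fin 2) | IsFactor u w ∧ u.length = D}.Finite).to_subtype

/-- The finite word which is a given letter of `A_D`. -/
def FactorAlphabet.word (A : FactorAlphabet w D) : List (Fin 2) := A.1

theorem FactorAlphabet.ext {A B : FactorAlphabet w D} (h : A.word = B.word) : A = B :=
  Subtype.ext h

@[simp] theorem FactorAlphabet.length_word (A : FactorAlphabet w D) : A.word.length = D := A.2.2

theorem FactorAlphabet.isFactor_word (A : FactorAlphabet w D) : IsFactor A.word w := A.2.1

theorem FactorAlphabet.exists_eq_factorAt (A : FactorAlphabet w D) :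
    ∃ j, A.word = factorAt w j D := by
  obtain ⟨j, hj⟩ := A.isFactor_word
  rw [OccursAt, A.length_word] at hj
  exact ⟨j, hj.symm⟩

theorem rho_eq_of_val_eq (hD : 0 < D) {A : FactorAlphabet w D} {u : ℕ → Fin 2} {n : ℕ}
    (h : A.word = factorAt u n D) : rho A = u n := by
  obtain ⟨E, rfl⟩ := Nat.exists_eq_add_of_le' hD
  change A.word.headD 0 = _
  rw [h, add_comm E 1, factorAt_add]
  simp [factorAt]

/-- A word over `A_D` is the coding of its image under `ρ` by successive factors of length `D`. -/
def IsCoding (y : ℕ → FactorAlphabet w D) : Prop :=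
  ∀ n, (y n).word = factorAt (rhoWord y) n D

/-- The coding of an infinite word by its successive factors of length `D`. -/
def coding (u : ℕ → Fin 2) (hu : ∀ n, IsFactor (factorAt u n D) w) :
    ℕ → FactorAlphabet w D :=
  fun n => ⟨factorAt u n D, hu n, by simp⟩

theorem rhoWord_eq (hD : 0 < D) {y : ℕ → FactorAlphabet w D} {u : ℕ → Fin 2}
    (h : ∀ n, (y n).word = factorAt u n D) : rhoWord y = u :=
  funext fun n => rho_eq_of_val_eq hD (h n)

theorem isCoding_of (hD : 0 < D) {y : ℕ → FactorAlphabet w D} {u : ℕ → Fin 2}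
    (h : ∀ n, (y n).word = factorAt u n D) : IsCoding y := by
  intro n
  rw [rhoWord_eq hD h]
  exact h n

theorem rhoWord_coding (hD : 0 < D) (u : ℕ → Fin 2) (hu : ∀ n, IsFactor (factorAt u n D) w) :
    rhoWord (coding u hu) = u := rhoWord_eq hD fun _ => rfl

theorem isCoding_coding (hD : 0 < D) (u : ℕ → Fin 2)
    (hu : ∀ n, IsFactor (factorAt u n D) w) : IsCoding (coding u hu) :=
  isCoding_of hD fun _ => rfl

theorem IsCoding.ext {y y' : ℕ → FactorAlphabet w D} (hy : IsCoding y) (hy' : IsCoding y')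
    (h : rhoWord y = rhoWord y') : y = y' :=
  funext fun n => FactorAlphabet.ext (by rw [hy, hy', h])

theorem rhoWord_shift (y : ℕ → FactorAlphabet w D) (j : ℕ) :
    rhoWord (shift^[j] y) = shift^[j] (rhoWord y) := by
  funext n; simp [rhoWord]

theorem IsCoding.shift {y : ℕ → FactorAlphabet w D} (hy : IsCoding y) (j : ℕ) :
    IsCoding (shift^[j] y) := by
  intro n
  rw [shift_iterate, hy, factorAt_eq_factorAt_iff, rhoWord_shift]
  intro k _
  rw [shift_iterate, add_assoc]

theorem FactorAlphabet.lt_iff {A B : FactorAlphabet w D} {u v : ℕ → Fin 2} {m n : ℕ}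
    (hA : A.word = factorAt u m D) (hB : B.word = factorAt v n D) :
    A < B ↔ ∃ i < D, (∀ j < i, u (m + j) = v (n + j)) ∧ u (m + i) < v (n + i) := by
  change A.word < B.word ↔ _
  rw [hA, hB, List.lt_iff_exists]
  simp only [length_factorAt, getElem_factorAt, lt_irrefl, and_false, false_or]
  constructor
  · rintro ⟨i, h, _, h1, h2⟩; exact ⟨i, h, h1, h2⟩
  · rintro ⟨i, h, h1, h2⟩; exact ⟨i, h, h, h1, h2⟩

/-- A first difference at `m` is first seen by the window starting at `m - (D - 1)`; truncated
subtraction gives the initial window when `m < D - 1`. -/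
theorem IsCoding.lt_of_rhoWord_lt (hD : 0 < D) {y y' : ℕ → FactorAlphabet w D}
    (hy : IsCoding y) (hy' : IsCoding y') (h : toLex (rhoWord y) < toLex (rhoWord y')) :
    toLex y < toLex y' := by
  obtain ⟨m, hm, hlt⟩ := h
  refine ⟨m - (D - 1), fun i hi => FactorAlphabet.ext ?_, ?_⟩
  · change (y i).word = (y' i).word
    rw [hy, hy', factorAt_eq_factorAt_iff]
    exact fun k hk => hm _ (by omega)
  · refine (FactorAlphabet.lt_iff (hy _) (hy' _)).2
      ⟨m - (m - (D - 1)), by omega, fun j hj => hm _ (by omega), ?_⟩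
    rw [show m - (D - 1) + (m - (m - (D - 1))) = m by omega]
    exact hlt

theorem IsCoding.lt_iff (hD : 0 < D) {y y' : ℕ → FactorAlphabet w D} (hy : IsCoding y)
    (hy' : IsCoding y') : toLex y < toLex y' ↔ toLex (rhoWord y) < toLex (rhoWord y') := by
  refine ⟨fun h => ?_, hy.lt_of_rhoWord_lt hD hy'⟩
  rcases lt_trichotomy (toLex (rhoWord y)) (toLex (rhoWord y')) with h1 | h1 | h1
  · exact h1
  · rw [hy.ext hy' (toLex.injective h1)] at h
    exact absurd h (lt_irrefl _)
  · exact absurd (hy'.lt_of_rhoWord_lt hD hy h1) h.asymm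

/-! ### The morphism `χ` -/

theorem length_piWord (v : List (Fin 2)) (hv : IsFactor v w) :
    (piWord D v hv).length = v.length + 1 - D := List.length_ofFn

theorem word_getElem_piWord (v : List (Fin 2)) (hv : IsFactor v w) {i : ℕ}
    (hi : i < (piWord D v hv).length) :
    ((piWord D v hv)[i]).word = (v.drop i).take D := by
  exact congrArg FactorAlphabet.word (List.getElem_ofFn _)

theorem chi_eq (hw : IsPureMorphic φ w) (A : FactorAlphabet w D) : chi φ w D hw A =
    (piWord D (onWords φ A.word) (hw.isFactor_onWords A.isFactor_word)).take
      (φ (rho A)).length := rfl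

/-- The `D - 1` letters of `A` after the first have non-empty images, so there are enough windows
and the prefix is not cut short. -/
theorem length_chi (hD : 0 < D) (hne : ∀ x, φ x ≠ []) (hw : IsPureMorphic φ w)
    (A : FactorAlphabet w D) : (chi φ w D hw A).length = (φ (rho A)).length := by
  obtain ⟨j, hj⟩ := A.exists_eq_factorAt
  have h0 : A.word = factorAt (Morphic.shift^[j] w) 0 D := by
    rw [hj, factorAt_eq_factorAt_iff]; simp
  have hr := rho_eq_of_val_eq hD h0
  obtain ⟨E, rfl⟩ := Nat.exists_eq_add_of_le' hD
  have hb := bdry_succ' φ (Morphic.shift^[j] w) E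
  have hle := le_bdry hne (Morphic.shift (Morphic.shift^[j] w)) E
  rw [chi_eq, List.length_take, length_piWord, h0, ← bdry, hr, Nat.succ_eq_add_one, zero_add, hb]
  omega

/-- The windows used by `χ` end within the image of the whole word `A`, so any infinite continuation
of `A` may be used to read them. -/
theorem getElem_chi (hD : 0 < D) (hne : ∀ x, φ x ≠ []) (hw : IsPureMorphic φ w)
    {A : FactorAlphabet w D} {u : ℕ → Fin 2} (hA : A.word = factorAt u 0 D) {i : ℕ}
    (hi : i < (chi φ w D hw A).length) :
    ((chi φ w D hw A)[i]).word = factorAt (onInfinite φ u) i D := by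
  have hr := rho_eq_of_val_eq hD hA
  have hi' := hi
  rw [length_chi hD hne] at hi'
  have hb : (φ (u 0)).length + D - 1 ≤ bdry φ u D := by
    obtain ⟨E, rfl⟩ := Nat.exists_eq_add_of_le' hD
    have hb := bdry_succ' φ u E
    have hle := le_bdry hne (Morphic.shift u) E
    rw [hb]
    omega
  simp only [chi_eq, List.getElem_take]
  rw [word_getElem_piWord, hA, ← factorAt_onInfinite]
  rw [hr] at hi'
  apply List.ext_getElem
  · simp; omega
  · intro k h1 h2
    simp

theorem chi_nonErasing (hD : 0 < D) (hne : ∀ x, φ x ≠ []) (hw : IsPureMorphic φ w)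
    (A : FactorAlphabet w D) : chi φ w D hw A ≠ [] := by
  rw [← List.length_pos_iff, length_chi hD hne]
  exact length_pos_of_nonErasing hne _

theorem map_rho_chi (hD : 0 < D) (hne : ∀ x, φ x ≠ []) (hw : IsPureMorphic φ w)
    (A : FactorAlphabet w D) : (chi φ w D hw A).map rho = φ (rho A) := by
  obtain ⟨j, hj⟩ := A.exists_eq_factorAt
  have h0 : A.word = factorAt (Morphic.shift^[j] w) 0 D := by
    rw [hj, factorAt_eq_factorAt_iff]; simp
  have hr := rho_eq_of_val_eq hD h0
  apply List.ext_getElem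
  · simp [length_chi hD hne]
  · intro k h1 h2
    rw [List.getElem_map, rho_eq_of_val_eq hD (getElem_chi hD hne hw h0 _),
      onInfinite_of_lt φ _ (by rwa [hr] at h2)]
    simp only [hr]

theorem map_rho_onWords_iterate (hD : 0 < D) (hne : ∀ x, φ x ≠ []) (hw : IsPureMorphic φ w)
    (v : List (FactorAlphabet w D)) (n : ℕ) :
    ((onWords (chi φ w D hw))^[n] v).map rho = (onWords φ)^[n] (v.map rho) := by
  have h1 : ∀ v, (onWords (chi φ w D hw) v).map rho = onWords φ (v.map rho) := by
    intro v
    induction v with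
    | nil => rfl
    | cons A v ih => simp [map_rho_chi hD hne, ih]
  induction n with
  | zero => rfl
  | succ n ih => rw [Function.iterate_succ_apply', Function.iterate_succ_apply', h1, ih]

/-- The conjugacy of `χ` with `φ`: `getElem_chi` settles the first image, and since `χ` and `φ` give
it the same length, the rest follows by shifting it off. -/
theorem IsCoding.onInfinite_val (hD : 0 < D) (hne : ∀ x, φ x ≠ []) (hw : IsPureMorphic φ w)
    {y : ℕ → FactorAlphabet w D} (hy : IsCoding y) (n : ℕ) :
    (onInfinite (chi φ w D hw) y n).word = factorAt (onInfinite φ (rhoWord y)) n D := by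
  induction n using Nat.strong_induction_on generalizing y with
  | _ n ih =>
    rcases lt_or_ge n (chi φ w D hw (y 0)).length with h | h
    · rw [onInfinite_of_lt _ _ h, getElem_chi hD hne hw (hy 0)]
    · obtain ⟨k, rfl⟩ := Nat.exists_eq_add_of_le h
      have hpos := length_pos_of_nonErasing (chi_nonErasing hD hne hw) (y 0)
      rw [onInfinite_add (chi_nonErasing hD hne hw)]
      refine (ih k (by omega) (hy.shift 1)).trans ?_
      rw [factorAt_eq_factorAt_iff, length_chi hD hne]
      intro i _
      rw [rhoWord_shift, add_assoc]
      change _ = Morphic.onInfinite φ (rhoWord y) ((φ (rhoWord y 0)).length + (k + i))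
      exact (onInfinite_add hne (rhoWord y) _).symm

theorem IsCoding.rhoWord_onInfinite (hD : 0 < D) (hne : ∀ x, φ x ≠ [])
    (hw : IsPureMorphic φ w) {y : ℕ → FactorAlphabet w D} (hy : IsCoding y) :
    rhoWord (onInfinite (chi φ w D hw) y) = onInfinite φ (rhoWord y) :=
  rhoWord_eq hD (hy.onInfinite_val hD hne hw)

theorem IsCoding.onInfinite (hD : 0 < D) (hne : ∀ x, φ x ≠ [])
    (hw : IsPureMorphic φ w) {y : ℕ → FactorAlphabet w D} (hy : IsCoding y) :
    IsCoding (onInfinite (chi φ w D hw) y) :=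
  isCoding_of hD (hy.onInfinite_val hD hne hw)

theorem IsCoding.onInfinite_eq_iff (hD : 0 < D) (hne : ∀ x, φ x ≠ [])
    (hw : IsPureMorphic φ w) {y : ℕ → FactorAlphabet w D} (hy : IsCoding y) :
    Morphic.onInfinite (chi φ w D hw) y = y ↔
      Morphic.onInfinite φ (rhoWord y) = rhoWord y := by
  rw [← hy.rhoWord_onInfinite hD hne hw]
  exact ⟨fun h => by rw [h], fun h => (hy.onInfinite hD hne hw).ext hy h⟩

/-! ### Fixed points of `χ` -/

theorem isPureMorphic_rhoWord (hD : 0 < D) (hne : ∀ x, φ x ≠ []) (hw : IsPureMorphic φ w)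
    {v : ℕ → FactorAlphabet w D} (hv : IsPureMorphic (chi φ w D hw) v) :
    IsPureMorphic φ (rhoWord v) := by
  have key : ∀ n, (onWords φ)^[n] [rhoWord v 0] =
      ((onWords (chi φ w D hw))^[n] [v 0]).map rho := fun n => by
    rw [map_rho_onWords_iterate hD hne]; rfl
  constructor
  · intro n
    rw [key, occursAt_iff]
    intro k hk
    rw [List.getElem_map, occursAt_iff.1 (hv.1 n)]
    rfl
  · intro N
    obtain ⟨n, hn⟩ := hv.2 N
    exact ⟨n, by rwa [key, List.length_map]⟩

theorem isPureMorphic_of_isCoding (hD : 0 < D) (hne : ∀ x, φ x ≠ []) (hw : IsPureMorphic φ w)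
    {v : ℕ → FactorAlphabet w D} (hc : IsCoding v) (hv : IsPureMorphic φ (rhoWord v)) :
    IsPureMorphic (chi φ w D hw) v := by
  refine isPureMorphic_of_onInfinite_eq ((hc.onInfinite_eq_iff hD hne hw).2 hv.onInfinite_eq)
    fun N => ?_
  obtain ⟨n, hn⟩ := hv.2 N
  refine ⟨n, ?_⟩
  rw [← List.length_map (f := rho), map_rho_onWords_iterate hD hne]
  exact hn

/-- Every letter occurs in `w`, hence fixed points have the same factors as `w`. -/
theorem IsPureMorphic.mem_orbitClosure (hw : IsPureMorphic φ w) (hD : IsSyncDelay φ w D)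
    {u : ℕ → Fin 2} (hu : IsPureMorphic φ u) : u ∈ orbitClosure w := by
  have hlet : IsFactor [u 0] w := by
    have := (hD.2 _ (isFactor_factorAt w 0 D) (by simp)).2 (u 0)
    obtain ⟨s, t, h⟩ := List.append_of_mem this
    refine (isFactor_factorAt w 0 D).of_infix ?_
    rw [h]
    exact ⟨s, t, by simp⟩
  have hfac : ∀ n, IsFactor ((onWords φ)^[n] [u 0]) w := by
    intro n
    induction n with
    | zero => exact hlet
    | succ n ih => rw [Function.iterate_succ_apply']; exact hw.isFactor_onWords ih
  rw [mem_orbitClosure_iff]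
  intro N
  obtain ⟨n, hn⟩ := hu.2 N
  obtain ⟨m, hm⟩ := hfac n
  refine ⟨m, fun i hi => ?_⟩
  rw [← occursAt_iff.1 hm i (by omega), occursAt_iff.1 (hu.1 n) i (by omega), zero_add]

/-- A fixed point of `χ` is determined by its first letter, so it is enough that this letter is the
prefix of length `D` of `ρ(v)`: the coding of `ρ(v)` is then a fixed point with the same start. -/
theorem IsPureMorphic.isCoding (hw : IsPureMorphic φ w) (hD : IsSyncDelay φ w D)
    (hne : ∀ x, φ x ≠ []) {v : ℕ → FactorAlphabet w D}
    (hv : IsPureMorphic (chi φ w D hw) v) : IsCoding v := by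
  have hD0 := hD.1
  have hu := isPureMorphic_rhoWord hD0 hne hw hv
  have hmem := hw.mem_orbitClosure hD hu
  have hlen : (v 0).word.length = D := (v 0).length_word
  -- the first letter of `v` is the prefix of `ρ(v)` of length `D`
  have hpre : (v 0).word <+: onWords φ (v 0).word := by
    obtain ⟨j, hj⟩ := (v 0).exists_eq_factorAt
    have h0 : (v 0).word = factorAt (Morphic.shift^[j] w) 0 D := by
      rw [hj, factorAt_eq_factorAt_iff]; simp
    have hpos := length_pos_of_nonErasing (chi_nonErasing hD0 hne hw) (v 0)
    have h1 := getElem_chi hD0 hne hw h0 hpos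
    rw [← onInfinite_of_lt _ v hpos, hv.onInfinite_eq] at h1
    have h2 : onWords φ (v 0).word = onWords φ (factorAt (shift^[j] w) 0 D) := by rw [h0]
    rw [h2, h1, ← factorAt_onInfinite]
    exact factorAt_prefix _ _ (le_bdry hne _ _)
  have hpre' : ∀ n, (v 0).word <+: (onWords φ)^[n] (v 0).word := by
    intro n
    induction n with
    | zero => exact List.prefix_rfl
    | succ n ih =>
      rw [Function.iterate_succ_apply]
      exact ih.trans (onWords_iterate_prefix φ hpre n)
  have hval : (v 0).word = factorAt (rhoWord v) 0 D := by
    obtain ⟨n, hn⟩ := hu.2 D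
    have hx : [rhoWord v 0] <+: (v 0).word := by
      obtain ⟨j, hj⟩ := (v 0).exists_eq_factorAt
      have : rhoWord v 0 = w j := rho_eq_of_val_eq hD0 hj
      rw [this, hj]
      simpa [factorAt] using factorAt_prefix w j hD0
    -- Both `v 0` and the iterate on its first symbol are prefixes of the iterate on `v 0`, and the
    -- former is not longer.
    have h1 := List.prefix_of_prefix_length_le (hpre' n) (onWords_iterate_prefix φ hx n)
      (by omega)
    have := (hu.1 n).of_prefix h1
    rw [OccursAt, hlen] at this
    exact this.symm
  have hcod := isCoding_coding (w := w) hD0 (rhoWord v)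
    fun n => .of_mem_orbitClosure hmem n D
  have hpm := isPureMorphic_of_isCoding hD0 hne hw hcod (by rwa [rhoWord_coding hD0])
  have := hv.ext hpm (FactorAlphabet.ext hval)
  rw [this]
  exact hcod

/-- Being a coding is a local condition, so it passes to the closure. Conversely, minimality places
`ρ(y)` in the orbit closure of `ρ(v)`, and `n` windows are read off a prefix of length `n + D`. -/
theorem mem_orbitClosure_chi_iff (hw : IsPureMorphic φ w) (hur : UniformlyRecurrent w)
    (hD : IsSyncDelay φ w D) (hne : ∀ x, φ x ≠ []) {v : ℕ → FactorAlphabet w D}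
    (hv : IsPureMorphic (chi φ w D hw) v) {y : ℕ → FactorAlphabet w D} :
    y ∈ orbitClosure v ↔ IsCoding y ∧ rhoWord y ∈ orbitClosure w := by
  have hD0 := hD.1
  have hu := hw.mem_orbitClosure hD (isPureMorphic_rhoWord hD0 hne hw hv)
  have hc := hw.isCoding hD hne hv
  constructor
  · intro hy
    rw [mem_orbitClosure_iff] at hy
    constructor
    · intro n
      obtain ⟨m, hm⟩ := hy (n + D)
      rw [hm n (by omega), hc, factorAt_eq_factorAt_iff]
      intro k hk
      simp only [rhoWord]
      rw [hm _ (by omega), add_assoc]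
    · rw [mem_orbitClosure_iff] at hu ⊢
      intro n
      obtain ⟨m, hm⟩ := hy n
      obtain ⟨l, hl⟩ := hu (m + n)
      refine ⟨l + m, fun i hi => ?_⟩
      have := hl (m + i) (by omega)
      rw [add_assoc, ← this]
      simp only [rhoWord]
      rw [hm i hi]
  · rintro ⟨hcy, hy⟩
    have := hur.mem_orbitClosure_of_factors hu hy
    rw [mem_orbitClosure_iff] at this ⊢
    intro n
    obtain ⟨m, hm⟩ := this (n + D)
    refine ⟨m, fun i hi => FactorAlphabet.ext ?_⟩
    rw [hcy, hc, factorAt_eq_factorAt_iff]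
    intro k hk
    rw [hm _ (by omega), add_assoc]

end Coding
-- Last letters of `χ`-images, separability, and the remaining transport along `ρ`.
section Separability

variable {φ : Fin 2 → List (Fin 2)} {w : ℕ → Fin 2} {D : ℕ}

theorem FactorAlphabet.exists_mem_orbitClosure (A : FactorAlphabet w D) :
    ∃ μ ∈ orbitClosure w, A.word = factorAt μ 0 D := by
  obtain ⟨j, hj⟩ := A.exists_eq_factorAt
  refine ⟨shift^[j] w, shift_mem_orbitClosure (self_mem_orbitClosure w) j, ?_⟩
  rw [hj, factorAt_eq_factorAt_iff]; simp

theorem getLast?_chi_eq_some_iff (hD : 0 < D) (hne : ∀ x, φ x ≠ []) (hw : IsPureMorphic φ w)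
    {A C : FactorAlphabet w D} {μ : ℕ → Fin 2} (hA : A.word = factorAt μ 0 D) :
    (chi φ w D hw A).getLast? = some C ↔
      C.word = factorAt (onInfinite φ μ) ((φ (μ 0)).length - 1) D := by
  have hpos := length_pos_of_nonErasing (chi_nonErasing hD hne hw) A
  rw [List.getLast?_eq_getElem?, List.getElem?_eq_getElem (by omega), Option.some_inj,
    ← rho_eq_of_val_eq hD hA, ← length_chi hD hne hw A,
    ← getElem_chi hD hne hw hA (Nat.sub_lt hpos one_pos)]
  exact ⟨fun h => by rw [h], fun h => (FactorAlphabet.ext h).symm⟩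

theorem endDifferently_chi (hne : ∀ x, φ x ≠ []) (hw : IsPureMorphic φ w)
    (hend : Function.Injective fun x => (φ x).getLast?) (hD : IsSyncDelay φ w D)
    {A B : FactorAlphabet w D} (hAB : chi φ w D hw A ≠ chi φ w D hw B) :
    EndDifferently (chi φ w D hw A) (chi φ w D hw B) := by
  have hD0 := hD.1
  have hA := List.getLast?_eq_some_getLast (chi_nonErasing hD0 hne hw A)
  have hB := List.getLast?_eq_some_getLast (chi_nonErasing hD0 hne hw B)
  refine ⟨_, hA, _, hB, fun hlast => hAB ?_⟩
  obtain ⟨μ, hμ, hAμ⟩ := A.exists_mem_orbitClosure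
  obtain ⟨ν, hν, hBν⟩ := B.exists_mem_orbitClosure
  rw [getLast?_chi_eq_some_iff hD0 hne hw hAμ] at hA
  rw [getLast?_chi_eq_some_iff hD0 hne hw hBν, ← hlast, hA, factorAt_eq_factorAt_iff] at hB
  have hμpos := length_pos_of_nonErasing hne (μ 0)
  have hνpos := length_pos_of_nonErasing hne (ν 0)
  -- At last places the remainders have length one, so the agreement required is exactly one window
  -- of length `D`.
  obtain ⟨h0, -⟩ := type_eq_of_agree hne hw hend hD (.of_mem_orbitClosure hμ 0 D)
    (.of_mem_orbitClosure hν 0 D) (p := (φ (μ 0)).length - 1) (q := (φ (ν 0)).length - 1)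
    (by omega) (by omega) (fun t ht => hB t (by omega))
  have hrA := rho_eq_of_val_eq hD0 hAμ
  have hrB := rho_eq_of_val_eq hD0 hBν
  have hlen : (chi φ w D hw A).length = (chi φ w D hw B).length := by
    rw [length_chi hD0 hne, length_chi hD0 hne, hrA, hrB, h0]
  refine List.ext_getElem hlen fun i h1 h2 => FactorAlphabet.ext ?_
  rw [getElem_chi hD0 hne hw hAμ, getElem_chi hD0 hne hw hBν, factorAt_eq_factorAt_iff]
  rw [length_chi hD0 hne, hrA] at h1
  intro k hk
  rcases lt_or_ge (i + k) (φ (μ 0)).length with h | h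
  · rw [onInfinite_of_lt φ μ h, onInfinite_of_lt φ ν (by rwa [← h0])]
    simp only [h0]
  · have := hB (i + k - ((φ (μ 0)).length - 1)) (by omega)
    rw [← h0] at this
    convert this using 2 <;> omega

theorem last_letter_chi_only_last (hne : ∀ x, φ x ≠ []) (hw : IsPureMorphic φ w)
    (hend : Function.Injective fun x => (φ x).getLast?) (hD : IsSyncDelay φ w D)
    {A B C : FactorAlphabet w D} (hC : C ∈ (chi φ w D hw A).getLast?) {i : ℕ}
    (hi : (chi φ w D hw B)[i]? = some C) : i + 1 = (chi φ w D hw B).length := by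
  have hD0 := hD.1
  obtain ⟨μ, hμ, hAμ⟩ := A.exists_mem_orbitClosure
  obtain ⟨ν, hν, hBν⟩ := B.exists_mem_orbitClosure
  obtain ⟨hlt, hi⟩ := List.getElem?_eq_some_iff.1 hi
  rw [Option.mem_def, getLast?_chi_eq_some_iff hD0 hne hw hAμ, ← hi,
    getElem_chi hD0 hne hw hBν, factorAt_eq_factorAt_iff] at hC
  rw [length_chi hD0 hne, rho_eq_of_val_eq hD0 hBν] at hlt ⊢
  exact marker hne hw hend hD (.of_mem_orbitClosure hμ 0 D) (.of_mem_orbitClosure hν 0 D) hlt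
    fun t ht => (hC t ht).symm

theorem lex_lt_of_agree {α : Type} [LT α] {a b a' b' : ℕ → α} {N : ℕ} (ha : ∀ i < N, a i = a' i)
    (hb : ∀ i < N, b i = b' i) (hab : ∃ i < N, a i ≠ b i) (h : toLex a < toLex b) :
    toLex a' < toLex b' := by
  obtain ⟨n, hn, hlt⟩ := lex_lt_iff.1 h
  obtain ⟨i, hi, hne⟩ := hab
  have hnN : n < N := by
    by_contra hcon
    exact hne (hn i (by omega))
  refine lex_lt_iff.2 ⟨n, fun j hj => ?_, ?_⟩
  · rw [← ha j (by omega), ← hb j (by omega), hn j hj]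
  · rwa [← ha n hnN, ← hb n hnN]

theorem lex_shift_lt_iff {α : Type} [LT α] {a b : ℕ → α} {p : ℕ} (h : ∀ i < p, a i = b i)
    (hirr : ∀ x : α, ¬ x < x) :
    toLex (shift^[p] a) < toLex (shift^[p] b) ↔ toLex a < toLex b := by
  simp only [lex_lt_iff, shift_iterate]
  constructor
  · rintro ⟨n, hn, hlt⟩
    refine ⟨p + n, fun i hi => ?_, hlt⟩
    rcases lt_or_ge i p with h1 | h1
    · exact h i h1
    · obtain ⟨k, rfl⟩ := Nat.exists_eq_add_of_le h1
      exact hn k (by omega)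
  · rintro ⟨n, hn, hlt⟩
    have hpn : p ≤ n := by
      by_contra hcon
      rw [h n (by omega)] at hlt
      exact hirr _ hlt
    obtain ⟨k, rfl⟩ := Nat.exists_eq_add_of_le hpn
    exact ⟨k, fun i hi => hn _ (by omega), hlt⟩

/-- The order of two words of different types depends on the types only. -/
theorem lex_lt_of_same_types (hne : ∀ x, φ x ≠ []) (hw : IsPureMorphic φ w)
    (hend : Function.Injective fun x => (φ x).getLast?) (hD : IsSyncDelay φ w D)
    {μ μ' ν ν' : ℕ → Fin 2} (hμ : μ ∈ orbitClosure w) (hν : ν ∈ orbitClosure w) {p q : ℕ}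
    (hp : p < (φ (μ 0)).length) (hq : q < (φ (ν 0)).length) (hμμ : ∀ i < D, μ i = μ' i)
    (hνν : ∀ i < D, ν i = ν' i) (hdiff : p = q → ∃ i < D, μ i ≠ ν i)
    (h : toLex (shift^[p] (onInfinite φ μ)) < toLex (shift^[q] (onInfinite φ ν))) :
    toLex (shift^[p] (onInfinite φ μ')) < toLex (shift^[q] (onInfinite φ ν')) := by
  have hD0 := hD.1
  have hμ' := onInfinite_congr hne (u := μ) (v := μ') (n := D - 1)
    (fun i hi => hμμ i (by omega))
  have hν' := onInfinite_congr hne (u := ν) (v := ν') (n := D - 1)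
    (fun i hi => hνν i (by omega))
  -- If the words differ within this stretch, the order is copied, as the first `D` letters of the
  -- preimages determine it. Otherwise the `φ`-types coincide and the order is that of the
  -- preimages, or its reverse, decided among those letters by `hdiff`.
  by_cases hagree : ∀ t < min ((φ (μ 0)).length - p) ((φ (ν 0)).length - q) + (D - 1),
      onInfinite φ μ (p + t) = onInfinite φ ν (q + t)
  · obtain ⟨h0, rfl⟩ := type_eq_of_agree hne hw hend hD (.of_mem_orbitClosure hμ 0 D)
      (.of_mem_orbitClosure hν 0 D) hp hq hagree
    have hd := hdiff rfl
    have hpre : ∀ i < p, onInfinite φ μ i = onInfinite φ ν i := fun i hi => by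
      rw [onInfinite_of_lt φ μ (hi.trans hp), onInfinite_of_lt φ ν (hi.trans hq)]
      simp only [h0]
    have hpre' : ∀ i < p, onInfinite φ μ' i = onInfinite φ ν' i := fun i hi => by
      rw [← hμ' i (by omega), ← hν' i (by omega), hpre i hi]
    rw [lex_shift_lt_iff hpre lt_irrefl] at h
    rw [lex_shift_lt_iff hpre' lt_irrefl]
    have hd' : ∃ i < D, ν i ≠ μ i := by
      obtain ⟨i, hi, hn⟩ := hd
      exact ⟨i, hi, hn.symm⟩
    have hneq : toLex μ ≠ toLex ν := by
      intro e
      obtain ⟨i, -, hn⟩ := hd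
      exact hn (congrFun (toLex.injective e) i)
    rcases onInfinite_strictMono_or_strictAnti hne hend with hm | hm
    · refine hm _ _ (lex_lt_of_agree hμμ hνν hd ?_)
      exact hneq.lt_or_gt.resolve_right fun e => h.asymm (hm _ _ e)
    · refine hm _ _ (lex_lt_of_agree hνν hμμ hd' ?_)
      exact hneq.lt_or_gt.resolve_left fun e => h.asymm (hm _ _ e)
  · push Not at hagree
    refine lex_lt_of_agree
      (N := min ((φ (μ 0)).length - p) ((φ (ν 0)).length - q) + (D - 1)) ?_ ?_ ?_ h
    · intro i hi
      rw [shift_iterate, shift_iterate, hμ' _ (by omega)]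
    · intro i hi
      rw [shift_iterate, shift_iterate, hν' _ (by omega)]
    · simpa using hagree

/-- Existence comes from compactness. For uniqueness, `ρ` turns two representations into
representations for `φ`, and codings are recovered from their `ρ`-images. -/
theorem typable_chi (hne : ∀ x, φ x ≠ []) (hw : IsPureMorphic φ w)
    (hur : UniformlyRecurrent w)
    (hend : Function.Injective fun x => (φ x).getLast?) (hD : IsSyncDelay φ w D)
    {v : ℕ → FactorAlphabet w D} (hv : IsPureMorphic (chi φ w D hw) v) :
    Typable (chi φ w D hw) (orbitClosure v) := by
  have hD0 := hD.1
  intro u hu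
  obtain ⟨r, hr⟩ := exists_represents (chi_nonErasing hD0 hne hw) hv.onInfinite_eq hu
  refine ⟨r, hr, ?_⟩
  rintro ⟨z, q⟩ ⟨hz, hq, hzu⟩
  obtain ⟨y, p⟩ := r
  obtain ⟨hy, hp, hyu⟩ := hr
  simp only at *
  rw [mem_orbitClosure_chi_iff hw hur hD hne hv] at hy hz
  rw [length_chi hD0 hne] at hp hq
  have he := congrArg rhoWord (hzu.symm.trans hyu)
  rw [rhoWord_shift, rhoWord_shift, hy.1.rhoWord_onInfinite hD0 hne hw,
    hz.1.rhoWord_onInfinite hD0 hne hw] at he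
  obtain ⟨h1, h2⟩ := represents_unique hne hw hend hD hz.2 hy.2 hq hp he
  rw [hz.1.ext hy.1 h1, h2]

theorem separable_chi (hne : ∀ x, φ x ≠ []) (hw : IsPureMorphic φ w)
    (hur : UniformlyRecurrent w)
    (hend : Function.Injective fun x => (φ x).getLast?) (hD : IsSyncDelay φ w D)
    {v : ℕ → FactorAlphabet w D} (hv : IsPureMorphic (chi φ w D hw) v) :
    Separable (chi φ w D hw) (orbitClosure v) := by
  have hD0 := hD.1
  have htyp := typable_chi hne hw hur hend hD hv
  refine ⟨htyp, ?_⟩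
  have hmem := fun y => mem_orbitClosure_chi_iff hw hur hD hne hv (y := y)
  -- a representative of each type
  have hrep : ∀ t : PossibleType (chi φ w D hw), ∃ y ∈ orbitClosure v, y 0 = t.1.1 := by
    intro t
    obtain ⟨μ, hμ, hA⟩ := t.1.1.exists_mem_orbitClosure
    have hfac : ∀ n, IsFactor (factorAt μ n D) w := fun n => .of_mem_orbitClosure hμ n D
    refine ⟨coding μ hfac, (hmem _).2 ⟨isCoding_coding hD0 _ _, ?_⟩, FactorAlphabet.ext hA.symm⟩
    rwa [rhoWord_coding hD0]
  choose rep hrepL hrep0 using hrep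
  -- One word of each type is chosen and types are ordered as these words. Typability makes `g`
  -- injective, and `lex_lt_of_same_types` makes the comparison independent of the choice.
  set g : PossibleType (chi φ w D hw) → Lex (ℕ → FactorAlphabet w D) := fun t =>
    toLex (shift^[t.1.2] (onInfinite (chi φ w D hw) (rep t))) with hg
  have hrepresents : ∀ t, Represents (chi φ w D hw) (orbitClosure v) (ofLex (g t))
      (rep t, t.1.2) := fun t => ⟨hrepL t, by simpa only [hrep0] using t.2, rfl⟩
  have hinj : Function.Injective g := by
    intro s t hst
    have h1 := hrepresents s
    have h2 := hrepresents t
    rw [hst] at h1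
    have hL : ofLex (g t) ∈ orbitClosure v :=
      shift_mem_orbitClosure (onInfinite_mem_orbitClosure (chi_nonErasing hD0 hne hw)
        hv.onInfinite_eq (hrepL t)) _
    have he := (htyp _ hL).unique h1 h2
    simp only [Prod.mk.injEq] at he
    refine Subtype.ext (Prod.ext ?_ he.2)
    rw [← hrep0 s, ← hrep0 t, he.1]
  refine ⟨LinearOrder.lift' g hinj, ?_⟩
  rintro u hu z hz s t ⟨-, y, ⟨hyL, hyp, hyu⟩, hy0⟩ ⟨-, y', ⟨hyL', hyp', hyu'⟩, hy0'⟩ hlt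
  have hst : g s < g t := hlt
  simp only at hyL hyp hyu hyL' hyp' hyu'
  have hR := fun t => (hmem _).1 (hrepL t)
  rw [hmem] at hyL hyL'
  have hcod : ∀ {y : ℕ → FactorAlphabet w D}, IsCoding y → ∀ p,
      IsCoding (shift^[p] (onInfinite (chi φ w D hw) y)) := fun hy p =>
    (hy.onInfinite hD0 hne hw).shift p
  subst hyu hyu'
  rw [(hcod hyL.1 _).lt_iff hD0 (hcod hyL'.1 _), rhoWord_shift, rhoWord_shift,
    hyL.1.rhoWord_onInfinite hD0 hne hw, hyL'.1.rhoWord_onInfinite hD0 hne hw]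
  rw [hg, (hcod (hR s).1 _).lt_iff hD0 (hcod (hR t).1 _), rhoWord_shift, rhoWord_shift,
    (hR s).1.rhoWord_onInfinite hD0 hne hw, (hR t).1.rhoWord_onInfinite hD0 hne hw] at hst
  have hword : ∀ {a b : ℕ → FactorAlphabet w D}, IsCoding a → IsCoding b →
      (a 0 = b 0 ↔ ∀ i < D, rhoWord a i = rhoWord b i) := by
    intro a b ha hb
    have : a 0 = b 0 ↔ (a 0).word = (b 0).word := ⟨fun h => by rw [h], FactorAlphabet.ext⟩
    rw [this, ha, hb, factorAt_eq_factorAt_iff]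
    simp
  have hlen : ∀ t : PossibleType (chi φ w D hw), t.1.2 < (φ (rhoWord (rep t) 0)).length := by
    intro t
    have := t.2
    rwa [length_chi hD0 hne, ← hrep0] at this
  refine lex_lt_of_same_types hne hw hend hD (hR s).2 (hR t).2 (hlen s) (hlen t)
    ((hword (hR s).1 hyL.1).1 ((hrep0 s).trans hy0.symm))
    ((hword (hR t).1 hyL'.1).1 ((hrep0 t).trans hy0'.symm)) (fun hpq => ?_) hst
  by_contra! hcon
  have hsame := (hword (hR s).1 (hR t).1).2 hcon
  rw [hrep0, hrep0] at hsame
  have : s = t := Subtype.ext (Prod.ext hsame hpq)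
  subst this
  exact lt_irrefl _ hst

/-! ### The isomorphism of the subshifts -/

/-- `ρ` as a homeomorphism of subshifts. -/
theorem exists_homeomorph (hne : ∀ x, φ x ≠ []) (hw : IsPureMorphic φ w)
    (hur : UniformlyRecurrent w) (hD : IsSyncDelay φ w D)
    {v : ℕ → FactorAlphabet w D} (hv : IsPureMorphic (chi φ w D hw) v) :
    ∃ e : orbitClosure v ≃ₜ orbitClosure w, ∀ y : orbitClosure v, (e y).1 = rhoWord y.1 := by
  have hD0 := hD.1
  have hmem := fun y => mem_orbitClosure_chi_iff hw hur hD hne hv (y := y)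
  have hcomp : CompactSpace (orbitClosure v) :=
    isCompact_iff_compactSpace.1 isClosed_closure.isCompact
  set F : orbitClosure v → orbitClosure w := fun y => ⟨rhoWord y.1, ((hmem _).1 y.2).2⟩
  have hF : Continuous F := by
    refine Continuous.subtype_mk (continuous_pi fun n => ?_) _
    exact (continuous_of_discreteTopology (f := rho)).comp
      ((continuous_apply n).comp continuous_subtype_val)
  have hbij : Function.Bijective F := by
    constructor
    · intro y y' h
      exact Subtype.ext (((hmem _).1 y.2).1.ext ((hmem _).1 y'.2).1 (congrArg Subtype.val h))
    · intro u
      have hr := rhoWord_coding (w := w) hD0 u.1 fun n => .of_mem_orbitClosure u.2 n D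
      exact ⟨⟨coding u.1 fun n => .of_mem_orbitClosure u.2 n D,
        (hmem _).2 ⟨isCoding_coding hD0 _ _, by rw [hr]; exact u.2⟩⟩, Subtype.ext hr⟩
  exact ⟨Continuous.homeoOfEquivCompactToT2 (f := Equiv.ofBijective F hbij) hF, fun _ => rfl⟩

/-- Injectivity holds because fixed points of `χ` are codings; for surjectivity, every fixed point
of `φ` has only factors of `w`, so it has a coding. -/
theorem bijOn_rhoWord_pureMorphic (hne : ∀ x, φ x ≠ []) (hw : IsPureMorphic φ w)
    (hD : IsSyncDelay φ w D) :
    Set.BijOn rhoWord {v | IsPureMorphic (chi φ w D hw) v} {u | IsPureMorphic φ u} := by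
  have hD0 := hD.1
  refine ⟨fun v hv => isPureMorphic_rhoWord hD0 hne hw hv, fun v hv v' hv' h =>
    (hw.isCoding hD hne hv).ext (hw.isCoding hD hne hv') h, fun u hu => ?_⟩
  have hmem := hw.mem_orbitClosure hD hu
  have hr := rhoWord_coding (w := w) hD0 u fun n => .of_mem_orbitClosure hmem n D
  exact ⟨_, isPureMorphic_of_isCoding hD0 hne hw (isCoding_coding hD0 _ _) (by rwa [hr]), hr⟩

theorem bijOn_rhoWord_fixed (hne : ∀ x, φ x ≠ []) (hw : IsPureMorphic φ w)
    (hur : UniformlyRecurrent w) (hD : IsSyncDelay φ w D)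
    {v : ℕ → FactorAlphabet w D} (hv : IsPureMorphic (chi φ w D hw) v) :
    Set.BijOn rhoWord {y | y ∈ orbitClosure v ∧ onInfinite (chi φ w D hw) y = y}
      {u | u ∈ orbitClosure w ∧ onInfinite φ u = u} := by
  have hD0 := hD.1
  have hmem := fun y => mem_orbitClosure_chi_iff hw hur hD hne hv (y := y)
  refine ⟨?_, ?_, ?_⟩
  · rintro y ⟨hy, hfix⟩
    obtain ⟨h1, h2⟩ := (hmem y).1 hy
    exact ⟨h2, (h1.onInfinite_eq_iff hD0 hne hw).1 hfix⟩
  · rintro y ⟨hy, -⟩ y' ⟨hy', -⟩ h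
    exact ((hmem y).1 hy).1.ext ((hmem y').1 hy').1 h
  · rintro u ⟨hu, hfix⟩
    have hr := rhoWord_coding (w := w) hD0 u fun n => .of_mem_orbitClosure hu n D
    have hc := isCoding_coding (w := w) hD0 u fun n => .of_mem_orbitClosure hu n D
    exact ⟨_, ⟨(hmem _).2 ⟨hc, by rwa [hr]⟩, (hc.onInfinite_eq_iff hD0 hne hw).2 (by rwa [hr])⟩,
      hr⟩

theorem orderPreservingOn_chi (hne : ∀ x, φ x ≠ []) (hw : IsPureMorphic φ w)
    (hur : UniformlyRecurrent w) (hD : IsSyncDelay φ w D)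
    (hφ : OrderPreservingOn φ (orbitClosure w))
    {v : ℕ → FactorAlphabet w D} (hv : IsPureMorphic (chi φ w D hw) v) :
    OrderPreservingOn (chi φ w D hw) (orbitClosure v) := by
  have hD0 := hD.1
  intro y hy z hz
  rw [mem_orbitClosure_chi_iff hw hur hD hne hv] at hy hz
  rw [hy.1.lt_iff hD0 hz.1, (hy.1.onInfinite hD0 hne hw).lt_iff hD0 (hz.1.onInfinite hD0 hne hw),
    hy.1.rhoWord_onInfinite hD0 hne hw, hz.1.rhoWord_onInfinite hD0 hne hw]
  exact hφ _ hy.2 _ hz.2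

end Separability
end Morphic

theorem propositionp (φ : Fin 2 → List (Fin 2)) (w : ℕ → Fin 2) (D : ℕ)
    (hw : IsPureMorphic φ w) (hap : ¬ UltimatelyPeriodic w) (hur : UniformlyRecurrent w)
    (hD : IsSyncDelay φ w D) :
    -- (1) `χ` is order-preserving on its subshift if `φ` is
    (OrderPreservingOn φ (orbitClosure w) →
      ∀ v, IsPureMorphic (chi φ w D hw) v →
        OrderPreservingOn (chi φ w D hw) (orbitClosure v)) ∧
    -- (2) last letters of `χ`-images
    (EndDifferently (φ 0) (φ 1) →
      (∀ A B, chi φ w D hw A ≠ chi φ w D hw B →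
        EndDifferently (chi φ w D hw A) (chi φ w D hw B)) ∧
      (∀ A B, ∀ C ∈ (chi φ w D hw A).getLast?, ∀ i,
        (chi φ w D hw B)[i]? = some C → i + 1 = (chi φ w D hw B).length)) ∧
    -- (3) fixed points, both as limits of iterates on a letter and as fixed elements of the subshift
    (Set.BijOn rhoWord {v | IsPureMorphic (chi φ w D hw) v} {u | IsPureMorphic φ u} ∧
      ∀ v, IsPureMorphic (chi φ w D hw) v →
        Set.BijOn rhoWord {y | y ∈ orbitClosure v ∧ onInfinite (chi φ w D hw) y = y}
          {u | u ∈ orbitClosure w ∧ onInfinite φ u = u}) ∧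
    -- (4) `ρ` is an isomorphism of subshifts that preserves the lexicographic order
    (EndDifferently (φ 0) (φ 1) →
      ∀ v, IsPureMorphic (chi φ w D hw) v →
        ∃ e : orbitClosure v ≃ₜ orbitClosure w,
          (∀ y : orbitClosure v, (e y).1 = rhoWord y.1) ∧
          (∀ y y' : orbitClosure v, y'.1 = shift y.1 → (e y').1 = shift (e y).1) ∧
          (∀ y y' : orbitClosure v, toLex y.1 < toLex y'.1 ↔ toLex (e y).1 < toLex (e y').1)) ∧
    -- (5) the subshift of `χ` is separable
    (EndDifferently (φ 0) (φ 1) →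
      ∀ v, IsPureMorphic (chi φ w D hw) v → Separable (chi φ w D hw) (orbitClosure v)) := by
  -- Aperiodicity enters only here, to exclude an erased letter.
  have hne := hw.nonErasing hap
  refine ⟨fun h v hv => orderPreservingOn_chi hne hw hur hD h hv, fun h => ?_,
    ⟨bijOn_rhoWord_pureMorphic hne hw hD, fun v hv => bijOn_rhoWord_fixed hne hw hur hD hv⟩,
    fun _ v hv => ?_, fun h v hv => separable_chi hne hw hur h.injective_getLast? hD hv⟩
  · have hend := h.injective_getLast?
    exact ⟨fun A B hAB => endDifferently_chi hne hw hend hD hAB,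
      fun A B C hC i hi => last_letter_chi_only_last hne hw hend hD hC hi⟩
  · obtain ⟨e, he⟩ := exists_homeomorph hne hw hur hD hv
    refine ⟨e, he, fun y y' h => ?_, fun y y' => ?_⟩
    · rw [he, he, h]; rfl
    · rw [he, he]
      exact ((mem_orbitClosure_chi_iff hw hur hD hne hv).1 y.2).1.lt_iff hD.1
        ((mem_orbitClosure_chi_iff hw hur hD hne hv).1 y'.2).1
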